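/- Fix integers $d\ge 1$ and $k\ge 0$. Let $S^{d-1}$ and $B^d=\{x\in\mathbb R^d: |x|\le 1\}$ be the Euclidean unit sphere and the closed unit ball of $\mathbb R^d$, and let $\sigma_k(t)=t^k$ for $t\ge 0$ and $\sigma_k(t)=0$ for $t<0$ (with $0^0=1$). There is a constant $C=C(d,k)$, depending only on $d$ and $k$, such that the following holds. For every integer $N\ge 6$ and every probability distribution $\tau$ on $S^{d-1}\times[-1,1]$ which is supported on $N$ points, there exists a probability distribution $\tau'$ on $S^{d-1}\times[-1,1]$ supported on at most $\left(1-\tfrac1{48}\right)N$ points such that for all multi-indices $\alpha$ with $|\alpha|\le k$, $$\sup_{x\in B^d}\left|D_x^\alpha\left(\int_{S^{d-1}\times[-1,1]}\sigma_k(\omega\cdot x+b)\,d\tau(\omega,b)-\int_{S^{d-1}\times[-1,1]}\sigma_k(\omega\cdot x+b)\,d\tau'(\omega,b)\right)\right|\le C\,N^{-\frac12-\frac{2(k-|\alpha|)+1}{2d}} .$$ Here the difference of the two integrals is a function of $x\in\mathbb R^d$ of class $C^{k-1}$ (if $k\geq 1$). For $|\alpha|<k$ and for $\alpha=0$, $D_x^\alpha$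 is the classical derivative; for $|\alpha|=k\ge1$ it is the weak derivative, and the bound holds at every point $x\in B^d$ for the representative obtained by differentiating under the integral sign with $$D_x^\alpha[\sigma_k(\omega\cdot x+b)]=\begin{cases}\frac{k!}{(k-|\alpha|)!}(\omega\cdot x+b)^{k-|\alpha|}\,\omega^\alpha & \omega\cdot x+b\ge 0,\\ 0 & \omega\cdot x+b<0.\end{cases}$$ -/

import Mathlib

open MeasureTheory
open scoped ContDiff

noncomputable section

namespace ShallowReLU

/-- The parameter space `S^{d-1} × [-1,1]`; a point is a pair `θ = (ω, b)`. -/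
abbrev Param (d : ℕ) : Type :=
  Metric.sphere (0 : EuclideanSpace ℝ (Fin d)) 1 × Set.Icc (-1 : ℝ) 1

/-- `μ` is supported on the finite set `S` (some points of `S` may carry no mass). -/
def SupportedOn {X : Type*} [MeasurableSpace X] (μ : Measure X) (S : Finset X) : Prop :=
  μ ((S : Set X)ᶜ) = 0

/-- The `ReLU^k` activation: `t ^ k` for `0 ≤ t` and `0` for `t < 0`.
Since `0 ^ 0 = 1`, the case `k = 0` is the Heaviside function with value `1` at `0`. -/
def relu (k : ℕ) (t : ℝ) : ℝ := if 0 ≤ t then t ^ k else 0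

/-- The function `x ↦ ∫ σ_k(ω · x + b) dτ(ω, b)` on `ℝ^d`. -/
def reluIntegral {d : ℕ} (k : ℕ) (τ : Measure (Param d)) (x : EuclideanSpace ℝ (Fin d)) : ℝ :=
  ∫ θ : Param d, relu k (inner ℝ (θ.1 : EuclideanSpace ℝ (Fin d)) x + (θ.2 : ℝ)) ∂τ

/-- The order `|α| = α_1 + ⋯ + α_d` of a multi-index. -/
def order {d : ℕ} (α : Fin d → ℕ) : ℕ := ∑ i, α i

/-- The partial derivative in the `i`-th coordinate direction. -/
def pderiv {d : ℕ} (i : Fin d) (f : EuclideanSpace ℝ (Fin d) → ℝ) :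
    EuclideanSpace ℝ (Fin d) → ℝ :=
  fun x => lineDeriv ℝ f x (EuclideanSpace.single i 1)

/-- The classical derivative `∂_1^{α_1} ⋯ ∂_d^{α_d} f`. -/
def multiDeriv {d : ℕ} (α : Fin d → ℕ) (f : EuclideanSpace ℝ (Fin d) → ℝ) :
    EuclideanSpace ℝ (Fin d) → ℝ :=
  (List.finRange d).foldr (fun i g => (pderiv i)^[α i] g) f

/-- `g` is the weak (distributional) derivative `D^α f` on `ℝ^d`. -/
def IsWeakDeriv {d : ℕ} (α : Fin d → ℕ) (f g : EuclideanSpace ℝ (Fin d) → ℝ) : Prop :=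
  LocallyIntegrable f ∧ LocallyIntegrable g ∧
    ∀ φ : EuclideanSpace ℝ (Fin d) → ℝ, ContDiff ℝ ∞ φ → HasCompactSupport φ →
      ∫ x, f x * multiDeriv α φ x = (-1) ^ order α * ∫ x, g x * φ x

/-- The everywhere defined representative of `D_x^α [σ_k(ω · x + b)]` for `|α| ≤ k`:
`k! / (k - |α|)! * (ω · x + b)^(k - |α|) * ω^α` where `0 ≤ ω · x + b`, and `0` elsewhere. -/
def reluDeriv {d : ℕ} (k : ℕ) (α : Fin d → ℕ) (θ : Param d) (x : EuclideanSpace ℝ (Fin d)) : ℝ :=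
  (k.descFactorial (order α) : ℝ)
    * relu (k - order α) (inner ℝ (θ.1 : EuclideanSpace ℝ (Fin d)) x + (θ.2 : ℝ))
    * ∏ i, (θ.1 : EuclideanSpace ℝ (Fin d)) i ^ α i

/-- The derivative of order `α` under the integral sign, `x ↦ ∫ D_x^α σ_k(ω · x + b) dτ(ω, b)`. -/
def reluIntegralDeriv {d : ℕ} (k : ℕ) (α : Fin d → ℕ) (τ : Measure (Param d))
    (x : EuclideanSpace ℝ (Fin d)) : ℝ :=
  ∫ θ : Param d, reluDeriv k α θ x ∂τ

end ShallowReLU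

end

/-!
The measure `τ'` is obtained from `τ = ∑ a θ δ_θ` by multiplying the weights `a θ ≤ 2 / N`, which
belong to at least half of the points, by `1 + x θ`, where `x` is a fractional coloring with values
in `[-1, 1]`. The points with `x θ = -1` disappear, and the error is, up to sign, the finite ridge
sum `F(y) = ∑ a θ * x θ * σ_k(ω · y + b)` over the light points (`reluSum`). For `N` below a constant
depending on `d` and `k` a point mass is good enough.

The coloring has to satisfy two sets of conditions, for a resolution `q` of the size of a small
multiple of `N ^ (1 / d)`.

* All derivatives of `F` of order less than `k` vanish at the points of a grid of mesh `2 / q` in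
  the ball. These are exact linear equations, fewer than a small multiple of `N`. By integration
  along segments the derivatives of order `k - m` are then `O (q ^ (-m))` times the derivatives of
  order `k` (`abs_reluSum_le_of_net`).
* The derivatives of order `k` are `O (N ^ (-1 / 2) q ^ (-1 / 2))` everywhere. At a point `y` they
  are weighted sums over `{θ | 0 ≤ ω · y + b}`. As `y` varies, these sets form a family of
  Vapnik–Chervonenkis dimension at most `d` (`vcDimLE_affine`), so by Haussler's packing lemma
  (`card_le_of_separated`) it has nets of the optimal cardinality `O (R ^ d)` at the resolution
  `1 / R`. Chaining through the resolutions `1 / (q * 4 ^ l)` gives the bound without logarithmic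
  loss, since the sums over the coarsest net can be made to vanish exactly
  (`exists_partial_coloring_of_vcDimLE`).

The coloring exists by a partial coloring lemma (`exists_partial_coloring`) with a short
variational proof: one maximizes the squared length of `x`, minus a sum of hyperbolic cosines that
penalizes large discrepancies, over the polytope given by all constraints. The second order
condition at the maximum forces a fixed proportion of the entries of `x` to be `±1`.
-/

namespace ShallowReLU

/-! ### Shattering and packing for families of sign patterns -/

/-- The family `F` of sign patterns shatters `I`: every pattern on `I` is the trace of a member
of `F`. -/
def Shatters {ι : Type*} (F : Set (ι → Bool)) (I : Finset ι) : Prop :=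
  ∀ g : ι → Bool, ∃ f ∈ F, ∀ i ∈ I, f i = g i

/-- The Vapnik–Chervonenkis dimension of `F` is at most `d`. -/
def VCDimLE {ι : Type*} (F : Set (ι → Bool)) (d : ℕ) : Prop :=
  ∀ I : Finset ι, Shatters F I → I.card ≤ d

theorem VCDimLE.mono {ι : Type*} {F G : Set (ι → Bool)} {d : ℕ} (h : VCDimLE G d) (hFG : F ⊆ G) :
    VCDimLE F d := fun I hI => h I fun g => by
  obtain ⟨f, hf, hfg⟩ := hI g
  exact ⟨f, hFG hf, hfg⟩

/-- A family pulled back along a map of index sets does not gain dimension: on a shattered set the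
map has to be injective. -/
theorem VCDimLE.comp {ι κ : Type*} {F : Set (ι → Bool)} {d : ℕ} (h : VCDimLE F d) (a : κ → ι) :
    VCDimLE ((fun f => f ∘ a) '' F) d := by
  classical
  intro I hI
  have hinj : Set.InjOn a I := by
    intro i hi j hj hij
    obtain ⟨_, ⟨f, -, rfl⟩, hf⟩ := hI (fun l => decide (l = i))
    have h1 := hf i hi
    have h2 := hf j hj
    simp only [Function.comp_apply, hij] at h1 h2
    rw [h1] at h2
    simpa [eq_comm] using h2
  rw [← Finset.card_image_of_injOn hinj]
  refine h _ fun g => ?_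
  obtain ⟨_, ⟨f, hfF, rfl⟩, hf⟩ := hI (g ∘ a)
  refine ⟨f, hfF, fun i hi => ?_⟩
  obtain ⟨j, hj, rfl⟩ := Finset.mem_image.1 hi
  exact hf j hj

/-- Patterns that extend to a member of `F` by some first entry. -/
theorem VCDimLE.tail_or {n d : ℕ} {F : Set (Fin (n + 1) → Bool)} (h : VCDimLE F d) :
    VCDimLE {q : Fin n → Bool | ∃ b : Bool, (Fin.cons b q : Fin (n + 1) → Bool) ∈ F} d := by
  intro I hI
  rw [← Finset.card_map (Fin.succEmb n)]
  refine h _ fun g => ?_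
  obtain ⟨q, ⟨b, hq⟩, hqg⟩ := hI (fun i => g i.succ)
  refine ⟨_, hq, fun i hi => ?_⟩
  obtain ⟨j, hj, rfl⟩ := Finset.mem_map.1 hi
  simpa using hqg j hj

/-- Patterns that extend to a member of `F` by both first entries: the dimension drops. -/
theorem VCDimLE.tail_and {n d : ℕ} {F : Set (Fin (n + 1) → Bool)} (h : VCDimLE F d) :
    ∀ I, Shatters {q : Fin n → Bool | ∀ b : Bool, (Fin.cons b q : Fin (n + 1) → Bool) ∈ F} I →
      I.card + 1 ≤ d := by
  intro I hI
  have h0 : (0 : Fin (n + 1)) ∉ I.map (Fin.succEmb n) := by simp [Fin.succ_ne_zero]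
  have : (insert 0 (I.map (Fin.succEmb n))).card = I.card + 1 := by
    rw [Finset.card_insert_of_notMem h0, Finset.card_map]
  rw [← this]
  refine h _ fun g => ?_
  obtain ⟨q, hq, hqg⟩ := hI (fun i => g i.succ)
  refine ⟨_, hq (g 0), fun i hi => ?_⟩
  rcases Finset.mem_insert.1 hi with rfl | hi
  · simp
  · obtain ⟨j, hj, rfl⟩ := Finset.mem_map.1 hi
    simpa using hqg j hj

theorem sum_fin_succ_bool {M : Type*} [AddCommMonoid M] {n : ℕ} (g : (Fin (n + 1) → Bool) → M) :
    ∑ q, g q = ∑ q : Fin n → Bool, (g (Fin.cons true q) + g (Fin.cons false q)) := by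
  rw [← (Fin.consEquiv fun _ : Fin (n + 1) => Bool).sum_comp g, Fintype.sum_prod_type_right]
  simp [Fin.consEquiv]

/-- Weighted form of the fact that the one-inclusion graph of a family of dimension `d` has at most
`d` times as many edges as vertices (every edge is counted twice). -/
theorem sum_min_flip_le : ∀ (n d : ℕ) (w : (Fin n → Bool) → ℕ), VCDimLE {q | w q ≠ 0} d →
    ∑ j, ∑ q, min (w q) (w (Function.update q j (!q j))) ≤ 2 * d * ∑ q, w q := by
  intro n
  induction n with
  | zero => intro d w _; simp
  | succ n ih =>
    intro d w hw
    set w₁ : (Fin n → Bool) → ℕ := fun q => max (w (Fin.cons true q)) (w (Fin.cons false q))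
      with hw₁
    set w₂ : (Fin n → Bool) → ℕ := fun q => min (w (Fin.cons true q)) (w (Fin.cons false q))
      with hw₂
    have h₁ : VCDimLE {q | w₁ q ≠ 0} d := hw.tail_or.mono fun q hq => by
      by_contra hcon
      simp only [Set.mem_ofPred_eq, not_exists, not_not] at hcon
      exact hq (by simp [hw₁, hcon])
    have h₂ := hw.tail_and
    have hsub : {q | w₂ q ≠ 0} ⊆
        {q : Fin n → Bool | ∀ b : Bool, (Fin.cons b q : Fin (n + 1) → Bool) ∈ {q | w q ≠ 0}} := by
      intro q hq b hb
      apply hq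
      cases b <;> simp [hw₂, hb]
    have hsum : ∑ q, w q = ∑ q, w₁ q + ∑ q, w₂ q := by
      rw [sum_fin_succ_bool, ← Finset.sum_add_distrib]
      refine Finset.sum_congr rfl fun q _ => ?_
      simp only [hw₁, hw₂]; omega
    have hE : ∑ j, ∑ q, min (w q) (w (Function.update q j (!q j))) ≤
        2 * ∑ q, w₂ q + (∑ j, ∑ q, min (w₁ q) (w₁ (Function.update q j (!q j))) +
          ∑ j, ∑ q, min (w₂ q) (w₂ (Function.update q j (!q j)))) := by
      rw [Fin.sum_univ_succ, ← Finset.sum_add_distrib]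
      refine add_le_add ?_ (Finset.sum_le_sum fun j _ => ?_)
      · rw [sum_fin_succ_bool, Finset.mul_sum]
        refine Finset.sum_le_sum fun q _ => ?_
        simp only [Fin.update_cons_zero, Fin.cons_zero, hw₂, Bool.not_true, Bool.not_false]
        omega
      · rw [sum_fin_succ_bool, ← Finset.sum_add_distrib]
        refine Finset.sum_le_sum fun q _ => ?_
        simp only [← Fin.cons_update, Fin.cons_succ, hw₁, hw₂]
        omega
    have hih₁ := ih d w₁ h₁
    have hih₂ : 2 * ∑ q, w₂ q + ∑ j, ∑ q, min (w₂ q) (w₂ (Function.update q j (!q j))) ≤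
        2 * d * ∑ q, w₂ q := by
      rcases d with _ | d
      · have h0 : ∀ q, w₂ q = 0 := by
          intro q
          by_contra hq
          have := h₂ ∅ fun g => ⟨q, hsub hq, by simp⟩
          omega
        simp [h0]
      · have := ih d w₂ (VCDimLE.mono (fun I hI => by have := h₂ I hI; omega) hsub)
        linarith
    rw [hsum]
    linarith

/-- Sauer–Shelah bound, in the crude form that is needed. -/
theorem card_le_of_vcDimLE : ∀ (n d : ℕ) (F : Finset (Fin n → Bool)),
    VCDimLE (F : Set (Fin n → Bool)) d → F.card ≤ (n + 1) ^ d := by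
  intro n
  induction n with
  | zero =>
    intro d F _
    have : F.card ≤ Fintype.card (Fin 0 → Bool) := F.card_le_univ
    simpa using this
  | succ n ih =>
    intro d F hF
    set F₁ : Finset (Fin n → Bool) := Finset.univ.filter fun q => ∃ b : Bool,
      (Fin.cons b q : Fin (n + 1) → Bool) ∈ F with hF₁
    set F₂ : Finset (Fin n → Bool) := Finset.univ.filter fun q => ∀ b : Bool,
      (Fin.cons b q : Fin (n + 1) → Bool) ∈ F with hF₂
    have hcard : F.card = F₁.card + F₂.card := by
      have h1 : F.card = ∑ q, if q ∈ F then 1 else 0 := by simp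
      rw [h1, sum_fin_succ_bool, hF₁, hF₂, Finset.card_filter, Finset.card_filter,
        ← Finset.sum_add_distrib]
      refine Finset.sum_congr rfl fun q _ => ?_
      by_cases ha : (Fin.cons true q : Fin (n + 1) → Bool) ∈ F <;>
        by_cases hb : (Fin.cons false q : Fin (n + 1) → Bool) ∈ F <;> simp [ha, hb]
    have h₁ := ih d F₁ (by simpa [hF₁] using hF.tail_or)
    have h₂ := hF.tail_and
    have h₃ : F₂.card * (n + 2) ≤ (n + 2) ^ d := by
      rcases d with _ | d
      · have : F₂ = ∅ := by
          by_contra hne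
          obtain ⟨q, hq⟩ := Finset.nonempty_iff_ne_empty.2 hne
          have := h₂ ∅ fun g => ⟨q, by simpa [hF₂] using hq, by simp⟩
          omega
        simp [this]
      · have := ih d F₂ (fun I hI => by
          have := h₂ I (by simpa [hF₂] using hI)
          omega)
        calc F₂.card * (n + 2) ≤ (n + 1) ^ d * (n + 2) := by gcongr
          _ ≤ (n + 2) ^ d * (n + 2) := by gcongr; omega
          _ = _ := by ring
    have h₄ : (n + 1) ^ d * (n + 2) ≤ (n + 1) * (n + 2) ^ d ∨ d = 0 := by
      rcases d with _ | d
      · simp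
      · left
        calc (n + 1) ^ (d + 1) * (n + 2) = (n + 1) * (n + 2) * (n + 1) ^ d := by ring
          _ ≤ (n + 1) * (n + 2) * (n + 2) ^ d := by gcongr; omega
          _ = _ := by ring
    rcases h₄ with h₄ | rfl
    · have : F.card * (n + 2) ≤ (n + 2) ^ d * (n + 2) := by
        rw [hcard]; nlinarith
      exact Nat.le_of_mul_le_mul_right this (by omega)
    · simp only [pow_zero] at *
      have : F₂.card = 0 := by
        by_contra h
        have : 1 ≤ F₂.card := Nat.one_le_iff_ne_zero.2 h
        nlinarith
      omega

/-- Both sides count the ordered pairs that the coordinate `a` separates. -/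
theorem two_mul_card_true_mul_card_false {ι : Type*} (Q : Finset (ι → Bool)) (a : ι) :
    2 * ((Q.filter fun p => p a = true).card * (Q.filter fun p => p a = false).card) =
      ∑ p ∈ Q, ∑ p' ∈ Q, if p a ≠ p' a then 1 else 0 := by
  have h : ∀ p ∈ Q, (∑ p' ∈ Q, if p a ≠ p' a then 1 else 0) =
      (if p a = true then (Q.filter fun p => p a = false).card else 0) +
        (if p a = false then (Q.filter fun p => p a = true).card else 0) := by
    intro p _
    rw [← Finset.card_filter]
    cases hp : p a <;> simp
  rw [Finset.sum_congr rfl h, Finset.sum_add_distrib, ← Finset.sum_filter, ← Finset.sum_filter]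
  simp only [Finset.sum_const, smul_eq_mul]
  ring

/-- Counting separated pairs: for a separated family, a coordinate splits the family into two
large parts on average. -/
theorem card_sub_one_le_sum_min {ι : Type*} [Fintype ι] {R : ℕ}
    (Q : Finset (ι → Bool))
    (hsep : ∀ p ∈ Q, ∀ p' ∈ Q, p ≠ p' → Fintype.card ι ≤ R * hammingDist p p') :
    Fintype.card ι * (Q.card - 1) ≤ R * ∑ a, 2 * min (Q.filter fun p => p a = true).card
      (Q.filter fun p => p a = false).card := by
  classical
  rcases Nat.eq_zero_or_pos Q.card with h0 | hpos
  · simp [h0]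
  have hpairs : Fintype.card ι * (Q.card * (Q.card - 1)) ≤
      R * ∑ p ∈ Q, ∑ p' ∈ Q, hammingDist p p' := by
    have h1 : ∀ p ∈ Q, Fintype.card ι * (Q.card - 1) ≤ ∑ p' ∈ Q, R * hammingDist p p' := by
      intro p hp
      calc Fintype.card ι * (Q.card - 1) = ∑ _p' ∈ Q.erase p, Fintype.card ι := by
            rw [Finset.sum_const, Finset.card_erase_of_mem hp, smul_eq_mul, mul_comm]
        _ ≤ ∑ p' ∈ Q.erase p, R * hammingDist p p' :=
            Finset.sum_le_sum fun p' hp' =>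
              hsep p hp p' (Finset.mem_of_mem_erase hp') (Finset.ne_of_mem_erase hp').symm
        _ ≤ ∑ p' ∈ Q, R * hammingDist p p' :=
            Finset.sum_le_sum_of_subset (Finset.erase_subset _ _)
    calc Fintype.card ι * (Q.card * (Q.card - 1)) = ∑ _p ∈ Q, Fintype.card ι * (Q.card - 1) := by
          rw [Finset.sum_const, smul_eq_mul]; ring
      _ ≤ ∑ p ∈ Q, ∑ p' ∈ Q, R * hammingDist p p' := Finset.sum_le_sum h1
      _ = _ := by simp only [Finset.mul_sum]
  have hswap : ∑ p ∈ Q, ∑ p' ∈ Q, hammingDist p p' = ∑ a,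
      2 * ((Q.filter fun p => p a = true).card * (Q.filter fun p => p a = false).card) := by
    simp only [two_mul_card_true_mul_card_false]
    simp only [hammingDist, Finset.card_filter]
    conv_rhs => rw [Finset.sum_comm]
    exact Finset.sum_congr rfl fun p _ => Finset.sum_comm
  have hmin : ∑ a, 2 * ((Q.filter fun p => p a = true).card *
      (Q.filter fun p => p a = false).card) ≤
      (∑ a, 2 * min (Q.filter fun p => p a = true).card
      (Q.filter fun p => p a = false).card) * Q.card := by
    rw [Finset.sum_mul]
    refine Finset.sum_le_sum fun a _ => ?_
    rw [mul_assoc, ← min_mul_max _ (Q.filter fun p => p a = false).card]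
    refine Nat.mul_le_mul_left _ (Nat.mul_le_mul_left _ ?_)
    exact max_le (Finset.card_filter_le _ _) (Finset.card_filter_le _ _)
  refine Nat.le_of_mul_le_mul_right ?_ hpos
  calc Fintype.card ι * (Q.card - 1) * Q.card = Fintype.card ι * (Q.card * (Q.card - 1)) := by ring
    _ ≤ R * ∑ p ∈ Q, ∑ p' ∈ Q, hammingDist p p' := hpairs
    _ ≤ R * ((∑ a, 2 * min (Q.filter fun p => p a = true).card
      (Q.filter fun p => p a = false).card) * Q.card) := by
        rw [hswap]; exact Nat.mul_le_mul_left _ hmin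
    _ = _ := by ring

theorem sum_insertNth_bool {s : ℕ} (j : Fin (s + 1)) (g : (Fin (s + 1) → Bool) → ℕ) :
    ∑ q, g q = ∑ q : Fin s → Bool,
      (g (Fin.insertNth j true q) + g (Fin.insertNth j false q)) := by
  rw [← (Fin.insertNthEquiv (fun _ : Fin (s + 1) => Bool) j).sum_comp g,
    Fintype.sum_prod_type_right]
  simp [Fin.insertNthEquiv]

theorem comp_insertNth {ι : Type*} {s : ℕ} (j : Fin (s + 1)) (a : ι) (f : Fin s → ι)
    (p : ι → Bool) :
    p ∘ (Fin.insertNth j a f : Fin (s + 1) → ι) = Fin.insertNth j (p a) (p ∘ f) := by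
  ext i
  refine Fin.succAboveCases j ?_ (fun i => ?_) i <;> simp

/-- For a separated family restricted to a sample, adding one random sample point in position `j`
cuts many members off from each other. -/
theorem card_sub_le_sum_sum_min {ι : Type*} [Fintype ι] [DecidableEq ι] {d R s : ℕ}
    (P : Finset (ι → Bool)) (hP : VCDimLE (P : Set (ι → Bool)) d)
    (hsep : ∀ p ∈ P, ∀ p' ∈ P, p ≠ p' → Fintype.card ι ≤ R * hammingDist p p')
    (j : Fin (s + 1)) (f : Fin s → ι) :
    Fintype.card ι * (P.card - (s + 1) ^ d) ≤ R * ∑ a, ∑ q,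
      min (P.filter fun p => p ∘ (Fin.insertNth j a f : Fin (s + 1) → ι) = q).card
        (P.filter fun p => p ∘ (Fin.insertNth j a f : Fin (s + 1) → ι) =
          Function.update q j (!q j)).card := by
  have hq : ∀ a, ∑ q,
      min (P.filter fun p => p ∘ (Fin.insertNth j a f : Fin (s + 1) → ι) = q).card
        (P.filter fun p => p ∘ (Fin.insertNth j a f : Fin (s + 1) → ι) =
          Function.update q j (!q j)).card =
      ∑ q : Fin s → Bool, 2 *
        min ((P.filter fun p => p ∘ f = q).filter fun p => p a = true).card
          ((P.filter fun p => p ∘ f = q).filter fun p => p a = false).card := by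
    intro a
    rw [sum_insertNth_bool j]
    refine Finset.sum_congr rfl fun q _ => ?_
    have hb : ∀ b : Bool, (P.filter fun p =>
        p ∘ (Fin.insertNth j a f : Fin (s + 1) → ι) = Fin.insertNth j b q) =
        (P.filter fun p => p ∘ f = q).filter fun p => p a = b := by
      intro b
      rw [Finset.filter_filter]
      refine Finset.filter_congr fun p _ => ?_
      rw [comp_insertNth, Fin.insertNth_injective2.eq_iff, and_comm]
    have hu : ∀ b : Bool, Function.update (Fin.insertNth j b q : Fin (s + 1) → Bool) j
        (!(Fin.insertNth j b q : Fin (s + 1) → Bool) j) = Fin.insertNth j (!b) q := by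
      intro b
      simp
    simp only [hu, hb, Bool.not_true, Bool.not_false]
    rw [min_comm ((P.filter fun p => p ∘ f = q).filter fun p => p a = false).card]
    ring
  simp only [hq]
  rw [Finset.sum_comm, Finset.mul_sum]
  set im := P.image fun p => p ∘ f
  have him : im.card ≤ (s + 1) ^ d := by
    refine card_le_of_vcDimLE s d _ ?_
    have := hP.comp f
    simpa [im] using this
  have hcard : P.card - (s + 1) ^ d ≤
      ∑ q : Fin s → Bool, ((P.filter fun p => p ∘ f = q).card - 1) := by
    have h1 : P.card = ∑ q ∈ im, (P.filter fun p => p ∘ f = q).card :=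
      Finset.card_eq_sum_card_image (fun p => p ∘ f) P
    have h2 : P.card ≤ ∑ q ∈ im, (((P.filter fun p => p ∘ f = q).card - 1) + 1) := by
      rw [h1]
      exact Finset.sum_le_sum fun q _ => by omega
    rw [Finset.sum_add_distrib, Finset.sum_const, smul_eq_mul, mul_one] at h2
    have h3 : ∑ q ∈ im, ((P.filter fun p => p ∘ f = q).card - 1) ≤
        ∑ q : Fin s → Bool, ((P.filter fun p => p ∘ f = q).card - 1) :=
      Finset.sum_le_sum_of_subset (Finset.subset_univ _)
    omega
  calc Fintype.card ι * (P.card - (s + 1) ^ d)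
      ≤ Fintype.card ι * ∑ q : Fin s → Bool, ((P.filter fun p => p ∘ f = q).card - 1) := by gcongr
    _ = ∑ q : Fin s → Bool, Fintype.card ι * ((P.filter fun p => p ∘ f = q).card - 1) :=
        Finset.mul_sum _ _ _
    _ ≤ _ := Finset.sum_le_sum fun q _ => card_sub_one_le_sum_min _ fun p hp p' hp' =>
        hsep p (Finset.mem_of_mem_filter p hp) p' (Finset.mem_of_mem_filter p' hp')

/-- Haussler's packing lemma: a family of dimension at most `d` whose members pairwise differ in a
proportion `1 / R` of the entries has `O(R ^ d)` members. -/
theorem card_le_of_separated {ι : Type*} [Fintype ι] {d R : ℕ} (hd : 1 ≤ d)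
    (hR : 1 ≤ R) (P : Finset (ι → Bool)) (hP : VCDimLE (P : Set (ι → Bool)) d)
    (hsep : ∀ p ∈ P, ∀ p' ∈ P, p ≠ p' → Fintype.card ι ≤ R * hammingDist p p') :
    P.card ≤ 2 * (4 * d * R) ^ d := by
  classical
  rcases Nat.eq_zero_or_pos (Fintype.card ι) with h0 | hn
  · have hι : IsEmpty ι := Fintype.card_eq_zero_iff.1 h0
    have : P.card ≤ Fintype.card (ι → Bool) := P.card_le_univ
    have h1 : 1 ≤ (4 * d * R) ^ d := Nat.one_le_pow _ _ (by positivity)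
    simp at this
    omega
  -- the number `s + 1` of sample points
  obtain ⟨s, hs⟩ : ∃ s, 4 * d * R = s + 1 := ⟨4 * d * R - 1, by
    have : 0 < 4 * d * R := by positivity
    omega⟩
  set n := Fintype.card ι with hn_def
  set W : (Fin (s + 1) → ι) → Fin (s + 1) → ℕ := fun f j => ∑ q,
    min (P.filter fun p => p ∘ f = q).card
      (P.filter fun p => p ∘ f = Function.update q j (!q j)).card with hW
  have hupper : ∀ f, ∑ j, W f j ≤ 2 * d * P.card := by
    intro f
    have h1 := sum_min_flip_le (s + 1) d (fun q => (P.filter fun p => p ∘ f = q).card)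
      ((hP.comp f).mono fun q hq => by
        obtain ⟨p, hp⟩ := Finset.card_ne_zero.1 hq
        rw [Finset.mem_filter] at hp
        exact ⟨p, hp.1, hp.2⟩)
    have h2 : ∑ q, (P.filter fun p => p ∘ f = q).card = P.card :=
      (Finset.card_eq_sum_card_fiberwise fun _ _ => Finset.mem_coe.2 (Finset.mem_univ _)).symm
    rwa [h2] at h1
  have hlower : ∀ j, n ^ s * (n * (P.card - (s + 1) ^ d)) ≤ R * ∑ f, W f j := by
    intro j
    rw [← (Fin.insertNthEquiv (fun _ : Fin (s + 1) => ι) j).sum_comp, Fintype.sum_prod_type_right,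
      Finset.mul_sum]
    have hc : n ^ s = (Finset.univ : Finset (Fin s → ι)).card := by simp [hn_def]
    rw [hc, ← smul_eq_mul, ← Finset.sum_const]
    exact Finset.sum_le_sum fun f _ => card_sub_le_sum_sum_min P hP hsep j f
  have hmain : (s + 1) * (n ^ (s + 1) * (P.card - (s + 1) ^ d)) ≤
      R * (n ^ (s + 1) * (2 * d * P.card)) := by
    calc (s + 1) * (n ^ (s + 1) * (P.card - (s + 1) ^ d))
        = ∑ _j : Fin (s + 1), n ^ s * (n * (P.card - (s + 1) ^ d)) := by
          rw [Finset.sum_const, Finset.card_univ, Fintype.card_fin, smul_eq_mul]; ring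
      _ ≤ ∑ j, R * ∑ f, W f j := Finset.sum_le_sum fun j _ => hlower j
      _ = R * ∑ f, ∑ j, W f j := by rw [← Finset.mul_sum, Finset.sum_comm]
      _ ≤ R * ∑ _f : Fin (s + 1) → ι, 2 * d * P.card := by
          gcongr with f _
          exact hupper f
      _ = _ := by
          rw [Finset.sum_const, Finset.card_univ, Fintype.card_fun, Fintype.card_fin, smul_eq_mul]
  rw [hs]
  have h4 : 2 * d * R * n ^ (s + 1) * (2 * (P.card - (s + 1) ^ d)) ≤
      2 * d * R * n ^ (s + 1) * P.card := by
    rw [← hs] at hmain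
    rw [← hs]
    calc _ = 4 * d * R * (n ^ (4 * d * R) * (P.card - (4 * d * R) ^ d)) := by ring
      _ ≤ _ := hmain
      _ = _ := by ring
  have h5 := Nat.le_of_mul_le_mul_left h4 (by positivity)
  omega

/-- A family of dimension at most `d` has, for every `R`, a subset of `O(R ^ d)` members such that
every member agrees with one of them outside a proportion `1 / R` of the entries. -/
theorem exists_net {ι : Type*} [Fintype ι] {d R : ℕ} (hd : 1 ≤ d)
    (hR : 1 ≤ R) (F : Set (ι → Bool)) (hF : VCDimLE F d) :
    ∃ P : Finset (ι → Bool), (P : Set (ι → Bool)) ⊆ F ∧ P.card ≤ 2 * (4 * d * R) ^ d ∧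
      ∀ f ∈ F, ∃ p ∈ P, f = p ∨ R * hammingDist f p < Fintype.card ι := by
  classical
  set good : Finset (Finset (ι → Bool)) := Finset.univ.filter fun P =>
    (P : Set (ι → Bool)) ⊆ F ∧
      ∀ p ∈ P, ∀ p' ∈ P, p ≠ p' → Fintype.card ι ≤ R * hammingDist p p' with hgood
  obtain ⟨P, hP⟩ := good.exists_maximal ⟨∅, by simp [hgood]⟩
  have hPg := hP.1
  simp only [hgood, Finset.mem_filter, Finset.mem_univ, true_and] at hPg
  refine ⟨P, hPg.1, card_le_of_separated hd hR P (hF.mono hPg.1) hPg.2, fun f hf => ?_⟩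
  by_contra! hcon
  have hins : insert f P ∈ good := by
    simp only [hgood, Finset.mem_filter, Finset.mem_univ, true_and, Finset.coe_insert,
      Set.insert_subset_iff]
    refine ⟨⟨hf, hPg.1⟩, fun p hp p' hp' hne => ?_⟩
    rcases Finset.mem_insert.1 hp with rfl | hp1 <;> rcases Finset.mem_insert.1 hp' with rfl | hp2
    · exact absurd rfl hne
    · exact (hcon p' hp2).2
    · rw [hammingDist_comm]; exact (hcon p hp1).2
    · exact hPg.2 p hp1 p' hp2 hne
  have hfP : f ∈ P := hP.2 hins (Finset.subset_insert f P) (Finset.mem_insert_self f P)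
  exact (hcon f hfP).1 rfl

/-- The sign patterns of `n` affine functions on a `d`-dimensional space have dimension at most `d`:
among `d + 1` of them some nontrivial linear combination is constant, and its sign excludes one of
two patterns. -/
theorem vcDimLE_affine {ι : Type*} {E : Type*} [NormedAddCommGroup E] [InnerProductSpace ℝ E]
    [FiniteDimensional ℝ E] (w : ι → E) (b : ι → ℝ) :
    VCDimLE (Set.range fun (x : E) (i : ι) => decide (0 ≤ inner ℝ (w i) x + b i))
      (Module.finrank ℝ E) := by
  classical
  intro I hI
  by_contra! hlt
  have hdep : ¬ LinearIndependent ℝ fun i : I => w i := fun h => by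
    have := h.fintype_card_le_finrank
    rw [Fintype.card_coe] at this
    omega
  rw [Fintype.not_linearIndependent_iff] at hdep
  obtain ⟨c, hc, i₀, hi₀⟩ := hdep
  have hconst : ∀ x : E, ∑ i : I, c i * (inner ℝ (w i) x + b i) = ∑ i : I, c i * b i := by
    intro x
    have : ∑ i : I, c i * inner ℝ (w i) x = 0 := by
      have h := congrArg (fun y => inner ℝ y x) hc
      simpa [sum_inner, inner_smul_left] using h
    simp only [mul_add, Finset.sum_add_distrib, this, zero_add]
  -- a pattern which is positive exactly where `e` is makes the combination nonnegative for
  -- `e = c`, and negative for `e = -c` as soon as `c` is positive somewhere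
  have key : ∀ e : I → ℝ, (∀ x : E, ∑ i : I, e i * (inner ℝ (w i) x + b i) = ∑ i : I, e i * b i) →
      (∃ i, 0 < e i) → False := by
    intro e he ⟨i₁, hi₁⟩
    obtain ⟨_, ⟨x, rfl⟩, hx⟩ := hI fun i => if h : i ∈ I then decide (0 < e ⟨i, h⟩) else false
    obtain ⟨_, ⟨y, rfl⟩, hy⟩ := hI fun i => if h : i ∈ I then decide (¬ 0 < e ⟨i, h⟩) else false
    have hx' : ∀ i : I, 0 ≤ inner ℝ (w i) x + b i ↔ 0 < e i := fun i => by
      have := hx i i.2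
      simpa using this
    have hy' : ∀ i : I, 0 ≤ inner ℝ (w i) y + b i ↔ ¬ 0 < e i := fun i => by
      have := hy i i.2
      by_cases h : 0 < e i <;> simpa [h] using this
    have h1 : 0 ≤ ∑ i : I, e i * (inner ℝ (w i) x + b i) := Finset.sum_nonneg fun i _ => by
      rcases lt_or_ge 0 (e i) with h | h
      · exact mul_nonneg h.le ((hx' i).2 h)
      · exact mul_nonneg_of_nonpos_of_nonpos h
          (le_of_lt (not_le.1 fun h' => absurd ((hx' i).1 h') (not_lt.2 h)))
    have h2 : ∑ i : I, e i * (inner ℝ (w i) y + b i) < 0 := by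
      refine Finset.sum_neg' (fun i _ => ?_) ⟨i₁, Finset.mem_univ _, ?_⟩
      · rcases lt_or_ge 0 (e i) with h | h
        · exact mul_nonpos_of_nonneg_of_nonpos h.le
            (le_of_lt (not_le.1 fun h' => (hy' i).1 h' h))
        · exact mul_nonpos_of_nonpos_of_nonneg h ((hy' i).2 (not_lt.2 h))
      · exact mul_neg_of_pos_of_neg hi₁ (not_le.1 fun h' => (hy' i₁).1 h' hi₁)
    rw [he] at h1 h2
    exact absurd h1 (not_le.2 h2)
  rcases lt_or_gt_of_ne hi₀ with h | h
  · refine key (fun i => -c i) (fun x => ?_) ⟨i₀, by simpa using h⟩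
    simpa [neg_mul, Finset.sum_neg_distrib] using hconst x
  · exact key c hconst ⟨i₀, h⟩

/-! ### Partial colorings by maximization of a potential -/

/-- Trace argument: if the quadratic form `∑ w j * ⟪v j, y⟫ ^ 2` has trace less than the dimension
of `W`, then it is smaller than `‖y‖ ^ 2` at some `y ∈ W`. -/
theorem exists_sum_inner_sq_lt {E : Type*} [NormedAddCommGroup E] [InnerProductSpace ℝ E]
    [FiniteDimensional ℝ E] {J : Type*} [Fintype J] (W : Submodule ℝ E) (w : J → ℝ) (v : J → E)
    (hw : ∀ j, 0 ≤ w j) (h : ∑ j, w j * ‖v j‖ ^ 2 < Module.finrank ℝ W) :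
    ∃ y ∈ W, ∑ j, w j * inner ℝ (v j) y ^ 2 < ‖y‖ ^ 2 := by
  by_contra! hcon
  set e := stdOrthonormalBasis ℝ W
  have he : Orthonormal ℝ fun i => (e i : E) := by
    have := e.orthonormal.comp_linearIsometry W.subtypeₗᵢ
    exact this
  have h1 : (Module.finrank ℝ W : ℝ) ≤ ∑ i, ∑ j, w j * inner ℝ (v j) (e i : E) ^ 2 := by
    have h2 : ∀ i, (1 : ℝ) ≤ ∑ j, w j * inner ℝ (v j) (e i : E) ^ 2 := fun i => by
      have := hcon (e i) (e i).2
      rwa [he.1 i, one_pow] at this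
    calc (Module.finrank ℝ W : ℝ) = ∑ _i : Fin (Module.finrank ℝ W), (1 : ℝ) := by simp
      _ ≤ _ := Finset.sum_le_sum fun i _ => h2 i
  rw [Finset.sum_comm] at h1
  have h3 : ∑ j, ∑ i, w j * inner ℝ (v j) (e i : E) ^ 2 ≤ ∑ j, w j * ‖v j‖ ^ 2 := by
    refine Finset.sum_le_sum fun j _ => ?_
    rw [← Finset.mul_sum]
    refine mul_le_mul_of_nonneg_left ?_ (hw j)
    have := he.sum_inner_products_le (v j) (s := Finset.univ)
    simpa [real_inner_comm, Real.norm_eq_abs, sq_abs] using this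
  linarith

theorem cosh_sub_one_le_sq {t : ℝ} (ht : |t| ≤ 1) : Real.cosh t - 1 ≤ t ^ 2 := by
  have h1 := Real.cosh_le_exp_half_sq t
  have h2 : t ^ 2 ≤ 1 := by rw [← sq_abs]; exact pow_le_one₀ (abs_nonneg t) ht
  have h3 := Real.exp_bound_div_one_sub_of_interval (x := t ^ 2 / 2) (by positivity) (by linarith)
  have h4 : 1 / (1 - t ^ 2 / 2) ≤ 1 + t ^ 2 := by
    rw [div_le_iff₀ (by linarith)]
    nlinarith [sq_nonneg t]
  linarith

/-- Second difference of the objective `∑ x ^ 2 - ∑ c cosh (a)` along a line. -/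
theorem second_difference_pos {ι J : Type*} [Fintype ι] [Fintype J] (x y : ι → ℝ)
    (c a b : J → ℝ) (hc : ∀ j, 0 ≤ c j) (hb : ∀ j, |b j| ≤ 1)
    (h : ∑ j, c j * Real.cosh (a j) * b j ^ 2 < ∑ i, y i ^ 2) :
    2 * (∑ i, x i ^ 2 - ∑ j, c j * Real.cosh (a j)) <
      (∑ i, (x i + y i) ^ 2 - ∑ j, c j * Real.cosh (a j + b j)) +
      (∑ i, (x i - y i) ^ 2 - ∑ j, c j * Real.cosh (a j - b j)) := by
  have h1 : ∑ i, (x i + y i) ^ 2 + ∑ i, (x i - y i) ^ 2 =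
      2 * ∑ i, x i ^ 2 + 2 * ∑ i, y i ^ 2 := by
    rw [Finset.mul_sum, Finset.mul_sum, ← Finset.sum_add_distrib, ← Finset.sum_add_distrib]
    exact Finset.sum_congr rfl fun i _ => by ring
  have h2 : ∑ j, c j * Real.cosh (a j + b j) + ∑ j, c j * Real.cosh (a j - b j) ≤
      2 * ∑ j, c j * Real.cosh (a j) + 2 * ∑ j, c j * Real.cosh (a j) * b j ^ 2 := by
    rw [Finset.mul_sum, Finset.mul_sum, ← Finset.sum_add_distrib, ← Finset.sum_add_distrib]
    refine Finset.sum_le_sum fun j _ => ?_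
    have h3 := cosh_sub_one_le_sq (hb j)
    have h4 : 0 ≤ c j * Real.cosh (a j) := mul_nonneg (hc j) (Real.cosh_pos _).le
    rw [Real.cosh_add, Real.cosh_sub]
    nlinarith [mul_le_mul_of_nonneg_left h3 h4]
  linarith

/-- The common kernel of finitely many linear functionals has codimension at most their number. -/
theorem exists_submodule_of_functionals {ι A : Type*} [Fintype ι] [Fintype A]
    (f : A → EuclideanSpace ℝ ι →ₗ[ℝ] ℝ) :
    ∃ W : Submodule ℝ (EuclideanSpace ℝ ι), (∀ y ∈ W, ∀ a, f a y = 0) ∧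
      Fintype.card ι ≤ Module.finrank ℝ W + Fintype.card A := by
  refine ⟨LinearMap.ker (LinearMap.pi f), fun y hy a => ?_, ?_⟩
  · rw [LinearMap.mem_ker] at hy
    exact congrFun hy a
  · have h1 := (LinearMap.pi f).finrank_range_add_finrank_ker
    have h2 : Module.finrank ℝ (LinearMap.range (LinearMap.pi f)) ≤ Fintype.card A := by
      have := (LinearMap.range (LinearMap.pi f)).finrank_le
      simpa using this
    rw [finrank_euclideanSpace] at h1
    omega

/-- A point can be moved a little in both directions without leaving a strict inequality. -/
theorem exists_pos_forall_abs_add_le {J : Type*} [Finite J] (p q s : J → ℝ)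
    (h : ∀ j, |p j| < s j ∨ (|p j| ≤ s j ∧ q j = 0)) :
    ∃ ε > 0, ∀ t : ℝ, |t| ≤ ε → ∀ j, |p j + t * q j| ≤ s j := by
  have h1 : ∀ j, ∀ᶠ t in nhds (0 : ℝ), |p j + t * q j| ≤ s j := by
    intro j
    rcases h j with hlt | ⟨hle, h0⟩
    · have hc : Continuous fun t : ℝ => |p j + t * q j| := by fun_prop
      have := hc.continuousAt.eventually_lt (x₀ := (0 : ℝ)) (continuousAt_const (y := s j))
        (by simpa using hlt)
      exact this.mono fun t ht => ht.le
    · exact Filter.Eventually.of_forall fun t => by simpa [h0] using hle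
  obtain ⟨ε, hε, hball⟩ := Metric.eventually_nhds_iff_ball.1 (Filter.eventually_all.2 h1)
  exact ⟨ε / 2, by positivity, fun t ht => hball t (by
    rw [Metric.mem_ball, Real.dist_0_eq_abs]; linarith)⟩

/-- Partial coloring. Given at most `n / 8` exact linear constraints `u`, and further vectors
`v j` of length at most `r j` with weights `c j` of total at most `n`, there is a fractional
coloring `x ∈ [-1, 1] ^ n`, with a quarter of its entries equal to `±1`, that satisfies the exact
constraints and has `|⟪v j, x⟫| ≤ 2 * r j * s j`, where `s j` is such that `16 ≤ c j * cosh (s j)`.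

The coloring maximizes `‖x‖² - ∑ c j * cosh (⟪v j, x⟫ / (2 * r j))` on the polytope cut out by the
constraints. The value at `0` bounds the potential at the maximum by `2 n`, so that few
constraints are tight and the Hessian of the potential has small trace. If few entries were
`±1`, the second order condition would fail in some direction tangent to all tight constraints. -/
theorem exists_partial_coloring {ι U J : Type*} [Fintype ι] [Fintype U] [Fintype J]
    (u : U → ι → ℝ) (v : J → ι → ℝ) (r c s : J → ℝ) (hr : ∀ j, 0 < r j)
    (hv : ∀ j, ∑ i, v j i ^ 2 ≤ r j ^ 2) (hc : ∀ j, 0 < c j)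
    (hcsum : ∑ j, c j ≤ Fintype.card ι) (hs : ∀ j, 0 ≤ s j)
    (hcs : ∀ j, 16 ≤ c j * Real.cosh (s j)) (hU : 8 * Fintype.card U ≤ Fintype.card ι) :
    ∃ x : ι → ℝ, (∀ i, |x i| ≤ 1) ∧ (∀ a, ∑ i, u a i * x i = 0) ∧
      (∀ j, |∑ i, v j i * x i| ≤ 2 * r j * s j) ∧
      Fintype.card ι ≤ 4 * (Finset.univ.filter fun i => |x i| = 1).card := by
  classical
  set n := Fintype.card ι with hn
  set K : Set (ι → ℝ) := {x | (∀ i, |x i| ≤ 1) ∧ (∀ a, ∑ i, u a i * x i = 0) ∧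
      (∀ j, |∑ i, v j i * x i| ≤ 2 * r j * s j)} with hK
  set a : (ι → ℝ) → J → ℝ := fun x j => (∑ i, v j i * x i) / (2 * r j) with ha
  set G : (ι → ℝ) → ℝ := fun x => ∑ i, x i ^ 2 - ∑ j, c j * Real.cosh (a x j) with hG
  have hKcomp : IsCompact K := by
    refine (isCompact_univ_pi fun _ : ι => isCompact_Icc (a := (-1 : ℝ))
      (b := 1)).of_isClosed_subset ?_ fun x hx i _ => abs_le.1 (hx.1 i)
    simp only [hK, Set.ofPred_and, Set.ofPred_forall]
    refine IsClosed.inter (isClosed_iInter fun i => isClosed_le (by fun_prop) (by fun_prop))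
      (IsClosed.inter (isClosed_iInter fun i => isClosed_eq (by fun_prop) (by fun_prop))
      (isClosed_iInter fun i => isClosed_le (by fun_prop) (by fun_prop)))
  have hK0 : (0 : ι → ℝ) ∈ K := by
    refine ⟨by simp, by simp, fun j => ?_⟩
    have := mul_nonneg (hr j).le (hs j)
    simp only [Pi.zero_apply, mul_zero, Finset.sum_const_zero, abs_zero]
    linarith
  have hGcont : Continuous G := by
    simp only [hG, ha]
    refine Continuous.sub (by fun_prop) (continuous_finsetSum _ fun j _ => ?_)
    exact continuous_const.mul (Real.continuous_cosh.comp (by fun_prop))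
  obtain ⟨x, hxK, hmax⟩ := hKcomp.exists_isMaxOn ⟨0, hK0⟩ hGcont.continuousOn
  refine ⟨x, hxK.1, hxK.2.1, hxK.2.2, ?_⟩
  by_contra! hfew
  -- the potential at the maximum
  have hpot : ∑ j, c j * Real.cosh (a x j) ≤ 2 * n := by
    have h0 : G 0 ≤ G x := hmax hK0
    have h1 : ∑ i, x i ^ 2 ≤ n := by
      calc ∑ i, x i ^ 2 ≤ ∑ _i : ι, (1 : ℝ) := Finset.sum_le_sum fun i _ => by
            rw [← sq_abs]; exact pow_le_one₀ (abs_nonneg _) (hxK.1 i)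
        _ = n := by simp [hn]
    simp only [hG, ha, Pi.zero_apply, mul_zero, Finset.sum_const_zero, zero_div, Real.cosh_zero,
      mul_one, ne_eq, OfNat.ofNat_ne_zero, not_false_eq_true, zero_pow, zero_sub] at h0 ⊢
    linarith
  set T : Finset J := Finset.univ.filter fun j => |∑ i, v j i * x i| = 2 * r j * s j with hT
  -- each tight constraint contributes at least `16` to the potential
  have hTcard : 8 * T.card ≤ n := by
    have h1 : (16 : ℝ) * T.card ≤ 2 * n := by
      calc (16 : ℝ) * T.card = ∑ _j ∈ T, (16 : ℝ) := by simp [mul_comm]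
        _ ≤ ∑ j ∈ T, c j * Real.cosh (a x j) := by
            refine Finset.sum_le_sum fun j hj => ?_
            have hj' : |∑ i, v j i * x i| = 2 * r j * s j := (Finset.mem_filter.1 hj).2
            have h2 : |a x j| = s j := by
              rw [ha]
              simp only [abs_div, hj']
              have := hr j
              rw [abs_of_pos (by positivity)]
              field_simp
            rw [← Real.cosh_abs, h2]
            exact hcs j
        _ ≤ ∑ j, c j * Real.cosh (a x j) :=
            Finset.sum_le_sum_of_subset_of_nonneg (Finset.subset_univ _)
              fun j _ _ => mul_nonneg (hc j).le (Real.cosh_pos _).le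
        _ ≤ _ := hpot
    have h2 : (16 * T.card : ℝ) ≤ (2 * n : ℕ) := by push_cast; exact h1
    have h3 : 16 * T.card ≤ 2 * n := by exact_mod_cast h2
    omega
  set S : Finset ι := Finset.univ.filter fun i => |x i| = 1 with hS
  let toLin : (ι → ℝ) → EuclideanSpace ℝ ι →ₗ[ℝ] ℝ := fun z =>
    (innerSL ℝ (WithLp.toLp 2 z)).toLinearMap
  have htoLin : ∀ z y, toLin z y = ∑ i, z i * y i := fun z y => by
    simp [toLin, PiLp.inner_apply, mul_comm]
  obtain ⟨W, hW, hWdim⟩ := exists_submodule_of_functionals (ι := ι) (A := S ⊕ U ⊕ T)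
    (Sum.elim (fun i => toLin (Pi.single i.1 1)) (Sum.elim (fun b => toLin (u b))
      (fun j => toLin (v j.1))))
  have hdim : (n : ℝ) / 2 < Module.finrank ℝ W := by
    simp only [Fintype.card_sum, Fintype.card_coe] at hWdim
    have : n < 2 * Module.finrank ℝ W := by omega
    have : (n : ℝ) < 2 * Module.finrank ℝ W := by exact_mod_cast this
    linarith
  -- a direction of `W` in which the second order condition fails
  obtain ⟨y, hyW, hy⟩ := exists_sum_inner_sq_lt W
    (fun j => c j * Real.cosh (a x j) / (2 * r j) ^ 2) (fun j => WithLp.toLp 2 (v j))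
    (fun j => div_nonneg (mul_nonneg (hc j).le (Real.cosh_pos _).le) (sq_nonneg _)) (by
      refine lt_of_le_of_lt ?_ hdim
      calc ∑ j, c j * Real.cosh (a x j) / (2 * r j) ^ 2 * ‖WithLp.toLp 2 (v j)‖ ^ 2
          ≤ ∑ j, c j * Real.cosh (a x j) / 4 := by
            refine Finset.sum_le_sum fun j _ => ?_
            have h1 : ‖WithLp.toLp 2 (v j)‖ ^ 2 ≤ r j ^ 2 := by
              rw [EuclideanSpace.norm_sq_eq]
              simpa using hv j
            have h2 : 0 ≤ c j * Real.cosh (a x j) := mul_nonneg (hc j).le (Real.cosh_pos _).le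
            have := hr j
            rw [div_mul_eq_mul_div, div_le_div_iff₀ (by positivity) (by norm_num)]
            nlinarith [mul_le_mul_of_nonneg_left h1 h2]
        _ = (∑ j, c j * Real.cosh (a x j)) / 4 := by rw [Finset.sum_div]
        _ ≤ n / 2 := by linarith)
  have hyS : ∀ i, |x i| = 1 → y i = 0 := fun i hi => by
    have := hW y hyW (Sum.inl ⟨i, by simp [hS, hi]⟩)
    simpa [htoLin, Pi.single_apply] using this
  have hyU : ∀ b, ∑ i, u b i * y i = 0 := fun b => by
    have := hW y hyW (Sum.inr (Sum.inl b))
    simpa [htoLin] using this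
  have hyT : ∀ j, |∑ i, v j i * x i| = 2 * r j * s j → ∑ i, v j i * y i = 0 := fun j hj => by
    have := hW y hyW (Sum.inr (Sum.inr ⟨j, by simp [hT, hj]⟩))
    simpa [htoLin] using this
  have hy' : ∑ j, c j * Real.cosh (a x j) * (a y j) ^ 2 < ∑ i, y i ^ 2 := by
    rw [EuclideanSpace.norm_sq_eq] at hy
    simp only [Real.norm_eq_abs, sq_abs] at hy
    convert hy using 2 with j
    have : inner ℝ (WithLp.toLp 2 (v j)) y = ∑ i, v j i * y i := by
      simp [PiLp.inner_apply, mul_comm]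
    rw [this, ha]
    have := hr j
    field_simp
  obtain ⟨ε₁, hε₁, h₁⟩ := exists_pos_forall_abs_add_le x y (fun _ => 1) fun i => by
    rcases (hxK.1 i).lt_or_eq with h | h
    · exact Or.inl h
    · exact Or.inr ⟨h.le, hyS i h⟩
  obtain ⟨ε₂, hε₂, h₂⟩ := exists_pos_forall_abs_add_le (fun j => ∑ i, v j i * x i)
    (fun j => ∑ i, v j i * y i) (fun j => 2 * r j * s j) fun j => by
    rcases (hxK.2.2 j).lt_or_eq with h | h
    · exact Or.inl h
    · exact Or.inr ⟨h.le, hyT j h⟩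
  obtain ⟨ε₃, hε₃, h₃⟩ := exists_pos_forall_abs_add_le (fun _ : J => 0) (fun j => a y j)
    (fun _ => 1) fun j => by simp
  set ε := min ε₁ (min ε₂ ε₃) with hε
  have hεpos : 0 < ε := by positivity
  have hmem : ∀ t : ℝ, |t| = ε → (fun i => x i + t * y i) ∈ K := by
    intro t ht
    have hlin : ∀ z : ι → ℝ, ∑ i, z i * (x i + t * y i) =
        ∑ i, z i * x i + t * ∑ i, z i * y i := fun z => by
      rw [Finset.mul_sum, ← Finset.sum_add_distrib]
      exact Finset.sum_congr rfl fun i _ => by ring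
    refine ⟨fun i => h₁ t (by rw [ht]; exact min_le_left _ _) i, fun b => ?_, fun j => ?_⟩
    · rw [hlin, hxK.2.1 b, hyU b]; ring
    · rw [hlin]
      exact h₂ t (by rw [ht]; exact (min_le_right _ _).trans (min_le_left _ _)) j
  have halin : ∀ (t : ℝ) j, a (fun i => x i + t * y i) j = a x j + t * a y j := fun t j => by
    simp only [ha]
    rw [mul_div_assoc', ← add_div, Finset.mul_sum, ← Finset.sum_add_distrib]
    congr 1
    exact Finset.sum_congr rfl fun i _ => by ring
  have hp : G (fun i => x i + ε * y i) ≤ G x := hmax (hmem ε (abs_of_pos hεpos))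
  have hm : G (fun i => x i + -ε * y i) ≤ G x := hmax (hmem (-ε) (by
    rw [abs_neg, abs_of_pos hεpos]))
  have hsd := second_difference_pos x (fun i => ε * y i) c (a x) (fun j => ε * a y j)
    (fun j => (hc j).le) (fun j => by
      have := h₃ ε (by
        rw [abs_of_pos hεpos]; exact (min_le_right _ _).trans (min_le_right _ _)) j
      simpa using this) (by
      simp only [mul_pow]
      rw [← Finset.mul_sum]
      calc ∑ j, c j * Real.cosh (a x j) * (ε ^ 2 * a y j ^ 2)
          = ε ^ 2 * ∑ j, c j * Real.cosh (a x j) * a y j ^ 2 := by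
            rw [Finset.mul_sum]; exact Finset.sum_congr rfl fun j _ => by ring
        _ < _ := by gcongr)
  simp only [hG, halin] at hp hm
  simp only [neg_mul, ← sub_eq_add_neg] at hm
  linarith

/-! ### Discrepancy of families of bounded dimension by chaining -/

theorem sum_half_pow_mul (A B : ℝ) (I : ℕ) :
    ∑ l ∈ Finset.range I, (1 / 2 : ℝ) ^ l * (A * l + B) =
      2 * A + 2 * B - 2 * (1 / 2 : ℝ) ^ I * (A * (I + 1) + B) := by
  induction I with
  | zero => simp; ring
  | succ I ih => rw [Finset.sum_range_succ, ih]; push_cast; ring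

theorem sum_quarter_pow_le_one (I : ℕ) :
    ∑ l ∈ Finset.range I, (1 / 4 : ℝ) ^ (l + 1) ≤ 1 := by
  have h : ∑ l ∈ Finset.range I, (1 / 4 : ℝ) ^ (l + 1) ≤ 1 - (1 / 4 : ℝ) ^ I := by
    induction I with
    | zero => simp
    | succ I ih =>
      rw [Finset.sum_range_succ]
      have : (0 : ℝ) < (1 / 4) ^ I := by positivity
      rw [pow_succ]
      linarith
  have : (0 : ℝ) < (1 / 4) ^ I := by positivity
  linarith

/-- The choice of the deviation parameter `2 * m + 5` that belongs to the weight `4 ^ (-m)`. -/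
theorem sixteen_le_weight_mul_cosh (m : ℕ) :
    16 ≤ (1 / 4 : ℝ) ^ m * Real.cosh (2 * m + 5) := by
  have h1 : (2 : ℝ) ^ (2 * m + 5) ≤ Real.exp (2 * m + 5) := by
    have h2 : (2 : ℝ) ≤ Real.exp 1 := by
      have := Real.add_one_le_exp (1 : ℝ); linarith
    calc (2 : ℝ) ^ (2 * m + 5) ≤ Real.exp 1 ^ (2 * m + 5) := by gcongr
      _ = _ := by rw [← Real.exp_nat_mul]; push_cast; ring_nf
  have h3 : Real.exp (2 * m + 5) / 2 ≤ Real.cosh (2 * m + 5) := by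
    rw [Real.cosh_eq]
    have := Real.exp_pos (-(2 * (m : ℝ) + 5))
    linarith
  have h4 : (1 / 4 : ℝ) ^ m * (2 ^ (2 * m + 5) / 2) = 16 := by
    rw [pow_add, pow_mul, one_div, inv_pow]
    field_simp
    norm_num
    ring
  rw [← h4]
  gcongr
  linarith

/-- Partial coloring for a family `F` of patterns of dimension at most `d`, with bounded weights
`g`: up to exact linear constraints the discrepancy is `O (√(n / q))`, where `q ^ d` is a small
multiple of `n`.

The members of `F` are approximated on nets of resolution `n / (q * 4 ^ l)`. The sums over the
coarsest net are made to vanish, and the differences between consecutive nets are bounded by the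
partial coloring lemma with geometrically decreasing weights. -/
theorem exists_partial_coloring_of_vcDimLE {ι U B : Type*} [Fintype ι] [Fintype U] [Fintype B]
    {d q : ℕ} (hd : 1 ≤ d) (hq : 1 ≤ q) (F : Set (ι → Bool)) (hF : VCDimLE F d)
    (g : B → ι → ℝ) (hg : ∀ β i, |g β i| ≤ 1) (u : U → ι → ℝ) (hn : 0 < Fintype.card ι)
    (hcard : 8 * (Fintype.card U + Fintype.card B * (2 * (4 * d * q) ^ d)) ≤ Fintype.card ι) :
    ∃ x : ι → ℝ, (∀ i, |x i| ≤ 1) ∧ (∀ a, ∑ i, u a i * x i = 0) ∧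
      (∀ f ∈ F, ∀ β, |∑ i, g β i * (if f i then 1 else 0) * x i| ≤
        (16 * d + 36) * √(Fintype.card ι / q)) ∧
      Fintype.card ι ≤ 4 * (Finset.univ.filter fun i => |x i| = 1).card := by
  classical
  set n := Fintype.card ι with hn_def
  have hR : ∀ l : ℕ, 1 ≤ q * 4 ^ l := fun l => Nat.mul_pos hq (by positivity)
  choose P hPF hPcard hPcov using fun l : ℕ => exists_net hd (hR l) F hF
  choose! π hπP hπ using hPcov
  have hdist : ∀ l, ∀ f ∈ F, q * 4 ^ l * hammingDist f (π l f) ≤ n := by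
    intro l f hf
    rcases hπ l f hf with h | h
    · rw [← h]; simp
    · exact h.le
  let J := B × (Σ l : Fin n, P (l + 1))
  let v : J → ι → ℝ := fun j i => g j.1 i *
    ((if j.2.2.1 i then 1 else 0) - (if π j.2.1 j.2.2.1 i then 1 else 0))
  let r : J → ℝ := fun j => √(n / q) * (1 / 2) ^ (j.2.1 : ℕ)
  let c : J → ℝ := fun j => (1 / 4) ^ (((j.2.1 : ℕ) + 1) * (d + 1))
  let s : J → ℝ := fun j => 2 * ((((j.2.1 : ℕ) + 1) * (d + 1) : ℕ) : ℝ) + 5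
  have hqR : (0 : ℝ) < q := by exact_mod_cast hq
  have hnR : (0 : ℝ) < n := by exact_mod_cast hn
  have hr : ∀ j, 0 < r j := fun j => by
    have := Real.sqrt_pos.2 (div_pos hnR hqR)
    positivity
  have hv : ∀ j, ∑ i, v j i ^ 2 ≤ r j ^ 2 := by
    rintro ⟨β, l, p, hp⟩
    have h1 : ∑ i, v (β, ⟨l, p, hp⟩) i ^ 2 ≤ hammingDist p (π l p) := by
      rw [hammingDist, Finset.card_filter]
      push_cast
      refine Finset.sum_le_sum fun i _ => ?_
      have h2 : g β i ^ 2 ≤ 1 := by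
        rw [← sq_abs]; exact pow_le_one₀ (abs_nonneg _) (hg β i)
      simp only [v]
      by_cases ha : p i = true <;> by_cases hb : π l p i = true <;> simp [ha, hb, h2]
    have h3 := hdist l p (hPF _ hp)
    have h4 : (q : ℝ) * 4 ^ (l : ℕ) * hammingDist p (π l p) ≤ n := by exact_mod_cast h3
    have h5 : r (β, ⟨l, p, hp⟩) ^ 2 = n / (q * 4 ^ (l : ℕ)) := by
      simp only [r]
      rw [mul_pow, Real.sq_sqrt (by positivity), ← pow_mul, mul_comm _ 2, pow_mul]
      rw [show ((1 : ℝ) / 2) ^ 2 = 1 / 4 by norm_num, one_div, inv_pow]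
      field_simp
    rw [h5]
    refine h1.trans ?_
    rw [le_div_iff₀ (by positivity)]
    linarith
  have hcsum : ∑ j, c j ≤ n := by
    have h1 : ∀ l : ℕ, ((P (l + 1)).card : ℝ) * (1 / 4) ^ ((l + 1) * (d + 1)) ≤
        2 * (4 * d * q) ^ d * (1 / 4) ^ (l + 1) := by
      intro l
      have h2 : ((P (l + 1)).card : ℝ) ≤ 2 * (4 * d * (q * 4 ^ (l + 1))) ^ d := by
        exact_mod_cast hPcard (l + 1)
      calc ((P (l + 1)).card : ℝ) * (1 / 4) ^ ((l + 1) * (d + 1))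
          ≤ 2 * (4 * d * (q * 4 ^ (l + 1))) ^ d * (1 / 4) ^ ((l + 1) * (d + 1)) := by gcongr
        _ = 2 * (4 * d * q) ^ d * (1 / 4) ^ (l + 1) *
            ((4 ^ (l + 1)) ^ d * ((1 / 4) ^ (l + 1)) ^ d) := by
            rw [pow_mul, pow_succ _ d, ← mul_assoc (4 * (d : ℝ)), mul_pow]
            ring
        _ = _ := by
            rw [← mul_pow, ← mul_pow]
            norm_num
    calc ∑ j, c j = ∑ _β : B, ∑ l : Fin n, ((P (l + 1)).card : ℝ) *
          (1 / 4) ^ (((l : ℕ) + 1) * (d + 1)) := by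
          rw [Fintype.sum_prod_type]
          refine Finset.sum_congr rfl fun β _ => ?_
          rw [Fintype.sum_sigma]
          refine Finset.sum_congr rfl fun l _ => ?_
          simp [c]
      _ ≤ ∑ _β : B, ∑ l : Fin n, 2 * (4 * d * q : ℝ) ^ d * (1 / 4) ^ ((l : ℕ) + 1) :=
          Finset.sum_le_sum fun _ _ => Finset.sum_le_sum fun l _ => h1 l
      _ = Fintype.card B * (2 * (4 * d * q : ℝ) ^ d *
            ∑ l ∈ Finset.range n, (1 / 4 : ℝ) ^ (l + 1)) := by
          rw [Finset.sum_const, Finset.card_univ, nsmul_eq_mul, ← Finset.mul_sum,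
            Finset.sum_range]
      _ ≤ Fintype.card B * (2 * (4 * d * q : ℝ) ^ d * 1) := by
          gcongr
          exact sum_quarter_pow_le_one n
      _ ≤ n := by
          have : Fintype.card B * (2 * (4 * d * q) ^ d) ≤ n := by omega
          rw [mul_one]
          exact_mod_cast this
  have hU : 8 * Fintype.card (U ⊕ (B × P 0)) ≤ n := by
    rw [Fintype.card_sum, Fintype.card_prod, Fintype.card_coe]
    have : Fintype.card B * (P 0).card ≤ Fintype.card B * (2 * (4 * d * q) ^ d) := by
      refine Nat.mul_le_mul_left _ ?_
      simpa using hPcard 0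
    omega
  obtain ⟨x, hx1, hxu, hxv, hxc⟩ := exists_partial_coloring
    (Sum.elim u fun (bp : B × P 0) i => g bp.1 i * (if bp.2.1 i then 1 else 0)) v r c s hr hv
    (fun j => by positivity) hcsum (fun j => by positivity)
    (fun j => sixteen_le_weight_mul_cosh _) hU
  refine ⟨x, hx1, fun a => hxu (Sum.inl a), fun f hf β => ?_, hxc⟩
  -- chaining: the sum over a member of the `l`-th net
  have hchain : ∀ l ≤ n, ∀ p ∈ P l, |∑ i, g β i * (if p i then 1 else 0) * x i| ≤
      2 * √(n / q) * ∑ l' ∈ Finset.range l, (1 / 2 : ℝ) ^ l' *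
        ((2 * (d + 1)) * l' + (2 * (d + 1) + 5)) := by
    intro l
    induction l with
    | zero =>
      intro _ p hp
      have := hxu (Sum.inr (β, ⟨p, hp⟩))
      simp only [Sum.elim_inr] at this
      rw [this]
      simp
    | succ l ih =>
      intro hl p hp
      have h1 := ih (by omega) (π l p) (hπP l p (hPF _ hp))
      have h2 := hxv (β, ⟨⟨l, by omega⟩, p, hp⟩)
      have h3 : ∑ i, g β i * (if p i then 1 else 0) * x i =
          ∑ i, v (β, ⟨⟨l, by omega⟩, p, hp⟩) i * x i +
            ∑ i, g β i * (if π l p i then 1 else 0) * x i := by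
        rw [← Finset.sum_add_distrib]
        refine Finset.sum_congr rfl fun i _ => ?_
        simp only [v]
        ring
      rw [h3, Finset.sum_range_succ, mul_add]
      refine (abs_add_le _ _).trans ?_
      rw [add_comm]
      refine add_le_add h1 (h2.trans (le_of_eq ?_))
      simp only [r, s]
      push_cast
      ring
  -- the `n`-th net is so fine that it contains all of `F`
  have hfP : f ∈ P n := by
    have h0 : f = π n f := by
      rcases hπ n f hf with h | h
      · exact h
      · by_contra hne
        have h1 : 1 ≤ hammingDist f (π n f) := hammingDist_pos.2 hne
        have h2 : n < 4 ^ n := Nat.lt_pow_self (by norm_num)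
        have h3 : 1 * 4 ^ n * 1 ≤ q * 4 ^ n * hammingDist f (π n f) := by gcongr
        omega
    rw [h0]
    exact hπP n f hf
  refine (hchain n le_rfl f hfP).trans ?_
  rw [sum_half_pow_mul]
  have h1 : (0 : ℝ) ≤ 2 * (1 / 2) ^ n * (2 * (d + 1) * (n + 1) + (2 * (d + 1) + 5)) := by
    positivity
  have h2 := Real.sqrt_nonneg ((n : ℝ) / q)
  nlinarith

/-! ### Calculus of the activation function -/

theorem relu_succ_eq_max_pow (m : ℕ) (t : ℝ) : relu (m + 1) t = max t 0 ^ (m + 1) := by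
  unfold relu
  split_ifs with h
  · rw [max_eq_left h]
  · rw [max_eq_right (not_le.1 h).le, zero_pow (by omega)]

theorem continuous_relu_succ (m : ℕ) : Continuous (relu (m + 1)) := by
  have : relu (m + 1) = fun t => max t 0 ^ (m + 1) := funext (relu_succ_eq_max_pow m)
  rw [this]
  fun_prop

theorem abs_relu_le (m : ℕ) (t : ℝ) : |relu m t| ≤ |t| ^ m := by
  unfold relu
  split_ifs
  · rw [abs_pow]
  · simp only [abs_zero]; positivity

/-- The activation function is differentiable away from `0`, and everywhere if `1 ≤ m`. -/
theorem hasDerivAt_relu_succ (m : ℕ) (t : ℝ) (h : 1 ≤ m ∨ t ≠ 0) :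
    HasDerivAt (relu (m + 1)) ((m + 1) * relu m t) t := by
  have hpow : HasDerivAt (fun s : ℝ => s ^ (m + 1)) ((m + 1) * t ^ m) t := by
    simpa using hasDerivAt_pow (m + 1) t
  rcases lt_trichotomy t 0 with ht | rfl | ht
  · have h0 : relu m t = 0 := if_neg (not_le.2 ht)
    rw [h0, mul_zero]
    refine (hasDerivAt_const t (0 : ℝ)).congr_of_eventuallyEq ?_
    filter_upwards [Iio_mem_nhds ht] with s hs
    exact if_neg (not_le.2 hs)
  · have hm : 1 ≤ m := h.resolve_right (by simp)
    have h0 : relu m 0 = 0 := by simp [relu]; omega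
    rw [h0, mul_zero, hasDerivAt_iff_isLittleO_nhds_zero]
    have h1 : relu (m + 1) 0 = 0 := by simp [relu]
    simp only [zero_add, h1, smul_zero, sub_zero]
    have h2 : (fun s : ℝ => relu (m + 1) s) =O[nhds 0] fun s : ℝ => s ^ (m + 1) :=
      Asymptotics.IsBigO.of_bound 1 (Filter.Eventually.of_forall fun s => by
        simpa [Real.norm_eq_abs] using abs_relu_le (m + 1) s)
    exact h2.trans_isLittleO (by
      simpa using Asymptotics.isLittleO_pow_pow (𝕜 := ℝ) (show 1 < m + 1 by omega))
  · have h0 : relu m t = t ^ m := if_pos ht.le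
    rw [h0]
    refine hpow.congr_of_eventuallyEq ?_
    filter_upwards [Ioi_mem_nhds ht] with s hs
    exact if_pos (le_of_lt hs)

theorem contDiff_relu_succ (m : ℕ) : ContDiff ℝ (m : ℕ∞) (relu (m + 1)) := by
  induction m with
  | zero => exact contDiff_zero.2 (continuous_relu_succ 0)
  | succ m ih =>
    have hd : ∀ t, HasDerivAt (relu (m + 1 + 1)) (((m + 1 : ℕ) + 1) * relu (m + 1) t) t :=
      fun t => hasDerivAt_relu_succ (m + 1) t (Or.inl (by omega))
    have h : ContDiff ℝ ((m : ℕ∞) + 1) (relu (m + 1 + 1)) := by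
      refine contDiff_succ_iff_deriv.2 ⟨fun t => (hd t).differentiableAt, fun h => ?_, ?_⟩
      · exact absurd h (by simp)
      · rw [funext fun t => (hd t).deriv]
        exact contDiff_const.mul ih
    exact_mod_cast h

theorem hasLineDerivAt_relu_inner {E : Type*} [NormedAddCommGroup E] [InnerProductSpace ℝ E]
    (m : ℕ) (w : E) (b : ℝ) (x v : E) (h : 1 ≤ m ∨ inner ℝ w x + b ≠ 0) :
    HasLineDerivAt ℝ (fun y => relu (m + 1) (inner ℝ w y + b))
      ((m + 1) * relu m (inner ℝ w x + b) * inner ℝ w v) x v := by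
  have h1 : HasDerivAt (fun t : ℝ => inner ℝ w (x + t • v) + b) (inner ℝ w v) 0 := by
    simp only [inner_add_right, inner_smul_right]
    simpa using (((hasDerivAt_id (0 : ℝ)).mul_const (inner ℝ w v)).const_add
      (inner ℝ w x)).add_const b
  have h2 := hasDerivAt_relu_succ m (inner ℝ w x + b) h
  have h3 : inner ℝ w (x + (0 : ℝ) • v) + b = inner ℝ w x + b := by simp
  rw [← h3] at h2
  have := HasDerivAt.comp (0 : ℝ) h2 h1
  rw [h3] at this
  exact this

theorem locallyIntegrable_relu_comp {E : Type*} [TopologicalSpace E] [MeasurableSpace E]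
    [BorelSpace E] [SecondCountableTopology E] [LocallyCompactSpace E]
    (μ : Measure E) [IsLocallyFiniteMeasure μ] (m : ℕ) {f : E → ℝ} (hf : Continuous f) :
    LocallyIntegrable (fun x => relu m (f x)) μ := by
  have h1 : (fun x => relu m (f x)) = Set.indicator {x | 0 ≤ f x} (fun x => f x ^ m) := by
    funext x
    simp [relu, Set.indicator]
  rw [h1]
  exact (hf.pow m).locallyIntegrable.indicator (isClosed_le continuous_const hf).measurableSet

/-- Fundamental theorem of calculus along a segment. It includes the case `m = 0`, where the
derivative `relu 0` has a jump, possibly along the whole segment. -/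
theorem integral_relu_inner_segment {E : Type*} [NormedAddCommGroup E] [InnerProductSpace ℝ E]
    (m : ℕ) (w : E) (b : ℝ) (x v : E) :
    IntervalIntegrable (fun t : ℝ => relu m (inner ℝ w (x + t • v) + b)) volume 0 1 ∧
    ∫ t in (0 : ℝ)..1, (m + 1) * relu m (inner ℝ w (x + t • v) + b) * inner ℝ w v =
      relu (m + 1) (inner ℝ w (x + v) + b) - relu (m + 1) (inner ℝ w x + b) := by
  have hc : Continuous fun t : ℝ => inner ℝ w (x + t • v) + b := by fun_prop
  have hi : IntervalIntegrable (fun t : ℝ => relu m (inner ℝ w (x + t • v) + b)) volume 0 1 :=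
    (intervalIntegrable_iff_integrableOn_Icc_of_le zero_le_one).2
      ((locallyIntegrable_relu_comp volume m hc).integrableOn_isCompact isCompact_Icc)
  refine ⟨hi, ?_⟩
  rcases eq_or_ne (inner ℝ w v) 0 with h0 | h0
  · simp [h0, inner_add_right]
  have hsub : {t : ℝ | inner ℝ w (x + t • v) + b = 0}.Subsingleton := by
    intro s hs t ht
    simp only [Set.mem_ofPred_eq, inner_add_right, inner_smul_right] at hs ht
    exact mul_right_cancel₀ h0 (by linarith)
  have h := integral_eq_of_hasDerivAt_off_countable
    (fun t : ℝ => relu (m + 1) (inner ℝ w (x + t • v) + b))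
    (fun t : ℝ => (m + 1) * relu m (inner ℝ w (x + t • v) + b) * inner ℝ w v)
    (a := 0) (b := 1) hsub.countable ((continuous_relu_succ m).comp hc).continuousOn
    (fun t ht => ?_) ((hi.const_mul _).mul_const _)
  · simpa using h
  · have h2 := hasDerivAt_relu_succ m (inner ℝ w (x + t • v) + b) (Or.inr ht.2)
    have h1 : HasDerivAt (fun t : ℝ => inner ℝ w (x + t • v) + b) (inner ℝ w v) t := by
      simp only [inner_add_right, inner_smul_right]
      simpa using (((hasDerivAt_id t).mul_const (inner ℝ w v)).const_add
      (inner ℝ w x)).add_const b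
    exact HasDerivAt.comp t h2 h1

/-- Integration by parts against a test function. For `m = 0` the function `relu 1` is only
Lipschitz and the formula for Lipschitz functions applies; for `1 ≤ m` it is differentiable. -/
theorem integral_relu_inner_mul_lineDeriv {E : Type*} [NormedAddCommGroup E]
    [InnerProductSpace ℝ E] [FiniteDimensional ℝ E] [MeasurableSpace E] [BorelSpace E]
    (m : ℕ) (w : E) (hw : w ≠ 0) (b : ℝ) (v : E) (ψ : E → ℝ) (hψ : ContDiff ℝ ∞ ψ)
    (hψc : HasCompactSupport ψ) :
    ∫ x, relu (m + 1) (inner ℝ w x + b) * lineDeriv ℝ ψ x v =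
      -∫ x, (m + 1) * relu m (inner ℝ w x + b) * inner ℝ w v * ψ x := by
  have hψd : Differentiable ℝ ψ := hψ.differentiable (by simp)
  have hl : Continuous fun x : E => inner ℝ w x + b := by fun_prop
  rcases Nat.eq_zero_or_pos m with rfl | hm
  · obtain ⟨D, hD⟩ := hψ.lipschitzWith_of_hasCompactSupport hψc (by simp)
    have hf : LipschitzWith ‖w‖₊ fun x : E => relu (0 + 1) (inner ℝ w x + b) := by
      refine LipschitzWith.of_dist_le_mul fun x y => ?_
      rw [relu_succ_eq_max_pow, relu_succ_eq_max_pow, zero_add, pow_one, pow_one, Real.dist_eq,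
        dist_eq_norm, coe_nnnorm]
      refine (abs_max_sub_max_le_abs _ _ _).trans ?_
      have : inner ℝ w x + b - (inner ℝ w y + b) = inner ℝ w (x - y) := by
        rw [inner_sub_right]; ring
      rw [this]
      exact abs_real_inner_le_norm _ _
    have h := LipschitzWith.integral_lineDeriv_mul_eq (μ := volume) hf hD hψc v
    -- the hyperplane where the derivative jumps is a null set
    have hnull : ∀ᵐ x : E, inner ℝ w x + b ≠ 0 := by
      let H : AffineSubspace ℝ E :=
        (AffineSubspace.mk' (0 : ℝ) ⊥).comap
          (((innerSL ℝ w).toLinearMap.toAffineMap) + AffineMap.const ℝ E b)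
      have hH : ∀ x, x ∈ H ↔ inner ℝ w x + b = 0 := fun x => by
        simp [H, AffineSubspace.mem_comap, AffineSubspace.mem_mk']
      have hne : H ≠ ⊤ := fun htop => by
        have h1 : (0 : E) ∈ H := htop ▸ AffineSubspace.mem_top ℝ E 0
        have h2 : w ∈ H := htop ▸ AffineSubspace.mem_top ℝ E w
        rw [hH] at h1 h2
        rw [inner_zero_right] at h1
        have : inner ℝ w w = 0 := by linarith
        exact hw (inner_self_eq_zero.1 this)
      have := Measure.addHaar_affineSubspace (volume : Measure E) H hne
      rw [ae_iff]
      convert this using 2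
      ext x
      simp [hH]
    have hae :
        (fun x => lineDeriv ℝ (fun x : E => relu (0 + 1) (inner ℝ w x + b)) x v * ψ x) =ᵐ[volume]
        fun x => ((0 : ℕ) + 1) * relu 0 (inner ℝ w x + b) * inner ℝ w v * ψ x := by
      filter_upwards [hnull] with x hx
      rw [(hasLineDerivAt_relu_inner 0 w b x v (Or.inr hx)).lineDeriv]
    rw [← integral_congr_ae hae, h, ← integral_neg]
    refine integral_congr_ae (Filter.Eventually.of_forall fun x => ?_)
    simp only [lineDeriv_neg]
    ring
  · have hf : ∀ x : E, HasLineDerivAt ℝ (fun y => relu (m + 1) (inner ℝ w y + b))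
        ((m + 1) * relu m (inner ℝ w x + b) * inner ℝ w v) x v :=
      fun x => hasLineDerivAt_relu_inner m w b x v (Or.inl hm)
    have hg : ∀ x : E, HasLineDerivAt ℝ ψ (lineDeriv ℝ ψ x v) x v :=
      fun x => (hψd x).lineDifferentiableAt.hasLineDerivAt
    have hlin : (fun x => lineDeriv ℝ ψ x v) = fun x => fderiv ℝ ψ x v :=
      funext fun x => (hψd x).lineDeriv_eq_fderiv
    have hgc : Continuous fun x => lineDeriv ℝ ψ x v := by
      rw [hlin]
      exact (hψ.continuous_fderiv (by simp)).clm_apply continuous_const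
    have hgs : HasCompactSupport fun x => lineDeriv ℝ ψ x v := by
      rw [hlin]
      exact hψc.fderiv_apply (𝕜 := ℝ) v
    exact integral_bilinear_hasLineDerivAt_right_eq_neg_left_of_integrable (μ := volume)
      (B := ContinuousLinearMap.mul ℝ ℝ)
      ((((locallyIntegrable_relu_comp volume m hl).smul (m + 1 : ℝ)).smul
        (inner ℝ w v)).integrable_smul_right_of_hasCompactSupport hψ.continuous hψc |>.congr
        (Filter.Eventually.of_forall fun x => by
          simp only [Pi.smul_apply, smul_eq_mul, ContinuousLinearMap.mul_apply']; ring))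
      ((locallyIntegrable_relu_comp volume (m + 1) hl).integrable_smul_right_of_hasCompactSupport
        hgc hgs)
      ((locallyIntegrable_relu_comp volume (m + 1) hl).integrable_smul_right_of_hasCompactSupport
        hψ.continuous hψc)
      (fun x _ => hf x) (fun x _ => hg x)

/-! ### Derivatives of finite ridge sums -/

theorem order_add {d : ℕ} (α β : Fin d → ℕ) : order (α + β) = order α + order β := by
  simp [order, Finset.sum_add_distrib]

theorem order_single {d : ℕ} (i : Fin d) (m : ℕ) : order (Pi.single i m : Fin d → ℕ) = m := by
  simp [order]

theorem order_zero {d : ℕ} : order (0 : Fin d → ℕ) = 0 := by simp [order]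

theorem order_list_sum {d : ℕ} (α : Fin d → ℕ) (l : List (Fin d)) :
    order ((l.map fun i => (Pi.single i (α i) : Fin d → ℕ)).sum) = (l.map α).sum := by
  induction l with
  | nil => simp [order_zero]
  | cons i l ih => simp [order_add, order_single, ih]

theorem list_sum_single {d : ℕ} (α : Fin d → ℕ) :
    ((List.finRange d).map fun i => (Pi.single i (α i) : Fin d → ℕ)).sum = α := by
  rw [← Fin.sum_univ_def, Finset.univ_sum_single]

theorem multiDeriv_of_order_eq_zero {d : ℕ} {α : Fin d → ℕ} (h : order α = 0)
    (f : EuclideanSpace ℝ (Fin d) → ℝ) : multiDeriv α f = f := by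
  have hα : ∀ i, α i = 0 := by simpa [order] using h
  unfold multiDeriv
  induction List.finRange d with
  | nil => rfl
  | cons i l ih => simp [hα] at ih ⊢

/-- A family of functions that is closed under first order partial derivatives below the order `k`
gives the iterated derivatives. -/
theorem multiDeriv_eq_of_pderiv {d k : ℕ} (D : (Fin d → ℕ) → EuclideanSpace ℝ (Fin d) → ℝ)
    (hD : ∀ γ i, order γ + 1 < k → pderiv i (D γ) = D (γ + Pi.single i 1))
    (α : Fin d → ℕ) (hα : order α < k) : multiDeriv α (D 0) = D α := by
  have hiter : ∀ (i : Fin d) (m : ℕ) (γ : Fin d → ℕ), order γ + m < k →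
      (pderiv i)^[m] (D γ) = D (γ + Pi.single i m) := by
    intro i m
    induction m with
    | zero => intro γ _; simp
    | succ m ih =>
      intro γ h
      rw [Function.iterate_succ_apply', ih γ (by omega), hD _ _ (by
        rw [order_add, order_single]; omega), add_assoc, ← Pi.single_add]
  have hlist : ∀ l : List (Fin d), (l.map α).sum < k →
      l.foldr (fun i g => (pderiv i)^[α i] g) (D 0) =
        D ((l.map fun i => (Pi.single i (α i) : Fin d → ℕ)).sum) := by
    intro l
    induction l with
    | nil => intro _; simp
    | cons i l ih =>
      intro h
      rw [List.map_cons, List.sum_cons] at h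
      rw [List.foldr_cons, ih (by omega), hiter _ _ _ (by rw [order_list_sum]; omega),
        List.map_cons, List.sum_cons, add_comm]
  have h := hlist (List.finRange d) (by
    rw [← order_list_sum, list_sum_single]; exact hα)
  rwa [list_sum_single] at h

theorem pderiv_eq_fderiv {d : ℕ} (i : Fin d) {ψ : EuclideanSpace ℝ (Fin d) → ℝ}
    (hψ : ContDiff ℝ ∞ ψ) : pderiv i ψ = fun x => fderiv ℝ ψ x (EuclideanSpace.single i 1) :=
  funext fun x => ((hψ.differentiable (by simp)) x).lineDeriv_eq_fderiv

theorem contDiff_pderiv {d : ℕ} (i : Fin d) {ψ : EuclideanSpace ℝ (Fin d) → ℝ}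
    (hψ : ContDiff ℝ ∞ ψ) : ContDiff ℝ ∞ (pderiv i ψ) := by
  rw [pderiv_eq_fderiv i hψ]
  exact (hψ.fderiv_right (m := ∞) (by simp)).clm_apply contDiff_const

theorem hasCompactSupport_pderiv {d : ℕ} (i : Fin d) {ψ : EuclideanSpace ℝ (Fin d) → ℝ}
    (hψ : ContDiff ℝ ∞ ψ) (hc : HasCompactSupport ψ) : HasCompactSupport (pderiv i ψ) := by
  rw [pderiv_eq_fderiv i hψ]
  exact hc.fderiv_apply (𝕜 := ℝ) _

/-- Iterated integration by parts. -/
theorem integral_mul_multiDeriv {d k : ℕ} (D : (Fin d → ℕ) → EuclideanSpace ℝ (Fin d) → ℝ)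
    (hD : ∀ γ i, order γ < k → ∀ ψ : EuclideanSpace ℝ (Fin d) → ℝ, ContDiff ℝ ∞ ψ →
      HasCompactSupport ψ → ∫ x, D γ x * pderiv i ψ x = -∫ x, D (γ + Pi.single i 1) x * ψ x)
    (α : Fin d → ℕ) (hα : order α ≤ k) (φ : EuclideanSpace ℝ (Fin d) → ℝ)
    (hφ : ContDiff ℝ ∞ φ) (hφc : HasCompactSupport φ) :
    ∫ x, D 0 x * multiDeriv α φ x = (-1) ^ order α * ∫ x, D α x * φ x := by
  have hreg : ∀ (i : Fin d) (m : ℕ) (ψ : EuclideanSpace ℝ (Fin d) → ℝ), ContDiff ℝ ∞ ψ →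
      HasCompactSupport ψ →
      ContDiff ℝ ∞ ((pderiv i)^[m] ψ) ∧ HasCompactSupport ((pderiv i)^[m] ψ) := by
    intro i m ψ hψ hψc
    induction m with
    | zero => exact ⟨hψ, hψc⟩
    | succ m ih =>
      rw [Function.iterate_succ_apply']
      exact ⟨contDiff_pderiv i ih.1, hasCompactSupport_pderiv i ih.1 ih.2⟩
  have hiter : ∀ (i : Fin d) (m : ℕ) (γ : Fin d → ℕ), order γ + m ≤ k →
      ∀ ψ : EuclideanSpace ℝ (Fin d) → ℝ, ContDiff ℝ ∞ ψ → HasCompactSupport ψ →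
      ∫ x, D γ x * (pderiv i)^[m] ψ x = (-1) ^ m * ∫ x, D (γ + Pi.single i m) x * ψ x := by
    intro i m
    induction m with
    | zero => intro γ _ ψ _ _; simp
    | succ m ih =>
      intro γ h ψ hψ hψc
      rw [Function.iterate_succ_apply', hD γ i (by omega) _ (hreg i m ψ hψ hψc).1
        (hreg i m ψ hψ hψc).2, ih _ (by rw [order_add, order_single]; omega) ψ hψ hψc, add_assoc,
        ← Pi.single_add, add_comm 1 m, pow_succ]
      ring
  have hlist : ∀ l : List (Fin d),
      (ContDiff ℝ ∞ (l.foldr (fun i g => (pderiv i)^[α i] g) φ) ∧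
        HasCompactSupport (l.foldr (fun i g => (pderiv i)^[α i] g) φ)) ∧
      ∀ γ, order γ + (l.map α).sum ≤ k →
      ∫ x, D γ x * l.foldr (fun i g => (pderiv i)^[α i] g) φ x = (-1) ^ (l.map α).sum *
        ∫ x, D (γ + (l.map fun i => (Pi.single i (α i) : Fin d → ℕ)).sum) x * φ x := by
    intro l
    induction l with
    | nil => exact ⟨⟨hφ, hφc⟩, fun γ _ => by simp⟩
    | cons i l ih =>
      refine ⟨hreg i (α i) _ ih.1.1 ih.1.2, fun γ h => ?_⟩
      rw [List.map_cons, List.sum_cons] at h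
      simp only [List.foldr_cons]
      rw [hiter i (α i) γ (by omega) _ ih.1.1 ih.1.2, ih.2 _ (by
        rw [order_add, order_single]; omega), List.map_cons, List.sum_cons, List.map_cons,
        List.sum_cons, add_assoc, pow_add]
      ring
  have h := (hlist (List.finRange d)).2 0 (by
    rw [← order_list_sum, list_sum_single, order_zero]; omega)
  rw [list_sum_single, zero_add, ← order_list_sum, list_sum_single] at h
  exact h

/-- The finite ridge sum `∑ c θ * D^α σ_k(ω · x + b)`. -/
noncomputable def reluSum {d : ℕ} (k : ℕ) (S : Finset (Param d)) (c : Param d → ℝ) (α : Fin d → ℕ)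
    (x : EuclideanSpace ℝ (Fin d)) : ℝ :=
  ∑ θ ∈ S, c θ * reluDeriv k α θ x

theorem reluDeriv_zero {d : ℕ} (k : ℕ) (θ : Param d) (x : EuclideanSpace ℝ (Fin d)) :
    reluDeriv k 0 θ x = relu k (inner ℝ (θ.1 : EuclideanSpace ℝ (Fin d)) x + (θ.2 : ℝ)) := by
  simp [reluDeriv, order_zero]

/-- The constant factor `k! / (k - |α|)! * ω^α` of `D^α σ_k(ω · x + b)`. -/
noncomputable def derivFactor {d : ℕ} (k : ℕ) (α : Fin d → ℕ) (θ : Param d) : ℝ :=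
  (k.descFactorial (order α) : ℝ) * ∏ i, (θ.1 : EuclideanSpace ℝ (Fin d)) i ^ α i

theorem reluDeriv_eq {d : ℕ} (k : ℕ) (α : Fin d → ℕ) (θ : Param d)
    (x : EuclideanSpace ℝ (Fin d)) :
    reluDeriv k α θ x = derivFactor k α θ *
      relu (k - order α) (inner ℝ (θ.1 : EuclideanSpace ℝ (Fin d)) x + (θ.2 : ℝ)) := by
  unfold reluDeriv derivFactor
  ring

theorem derivFactor_add_single {d k m : ℕ} {α : Fin d → ℕ} (h : k - order α = m + 1) (i : Fin d)
    (θ : Param d) : derivFactor k (α + Pi.single i 1) θ =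
      derivFactor k α θ * ((m + 1) * (θ.1 : EuclideanSpace ℝ (Fin d)) i) := by
  have h1 : ∏ j, (θ.1 : EuclideanSpace ℝ (Fin d)) j ^ (α + Pi.single i 1 : Fin d → ℕ) j =
      (∏ j, (θ.1 : EuclideanSpace ℝ (Fin d)) j ^ α j) * (θ.1 : EuclideanSpace ℝ (Fin d)) i := by
    simp only [Pi.add_apply, pow_add, Finset.prod_mul_distrib]
    congr 1
    rw [Finset.prod_eq_single i]
    · simp
    · intro j _ hj
      simp [Pi.single_eq_of_ne hj]
    · simp
  unfold derivFactor
  rw [h1, order_add, order_single, Nat.descFactorial_succ, h]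
  push_cast
  ring

theorem inner_single_right {d : ℕ} (w : EuclideanSpace ℝ (Fin d)) (i : Fin d) :
    inner ℝ w (EuclideanSpace.single i (1 : ℝ)) = w i := by
  simp [EuclideanSpace.inner_single_right]

theorem abs_coord_le_one {d : ℕ} (w : Metric.sphere (0 : EuclideanSpace ℝ (Fin d)) 1)
    (i : Fin d) : |(w : EuclideanSpace ℝ (Fin d)) i| ≤ 1 := by
  have h1 := PiLp.norm_apply_le (w : EuclideanSpace ℝ (Fin d)) i
  rwa [norm_eq_of_mem_sphere, Real.norm_eq_abs] at h1

theorem hasLineDerivAt_reluDeriv {d k : ℕ} {α : Fin d → ℕ} (h : order α + 1 < k) (i : Fin d)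
    (θ : Param d) (x : EuclideanSpace ℝ (Fin d)) :
    HasLineDerivAt ℝ (reluDeriv k α θ) (reluDeriv k (α + Pi.single i 1) θ x) x
      (EuclideanSpace.single i 1) := by
  obtain ⟨m, hm⟩ : ∃ m, k - order α = m + 1 := ⟨k - order α - 1, by omega⟩
  have h1 := hasLineDerivAt_relu_inner m (θ.1 : EuclideanSpace ℝ (Fin d)) (θ.2 : ℝ) x
    (EuclideanSpace.single i 1) (Or.inl (by omega))
  rw [inner_single_right] at h1
  have h2 : reluDeriv k α θ = fun x => derivFactor k α θ *
      relu (m + 1) (inner ℝ (θ.1 : EuclideanSpace ℝ (Fin d)) x + (θ.2 : ℝ)) := by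
    funext x
    rw [reluDeriv_eq, hm]
  rw [h2, reluDeriv_eq, derivFactor_add_single hm, order_add, order_single,
    show k - (order α + 1) = m by omega]
  exact (HasDerivAt.const_mul (derivFactor k α θ) h1).congr_deriv (by ring)

theorem pderiv_reluSum {d k : ℕ} (S : Finset (Param d)) (c : Param d → ℝ) {α : Fin d → ℕ}
    (h : order α + 1 < k) (i : Fin d) :
    pderiv i (reluSum k S c α) = reluSum k S c (α + Pi.single i 1) := by
  funext x
  refine HasLineDerivAt.lineDeriv ?_
  unfold HasLineDerivAt reluSum
  exact HasDerivAt.fun_sum fun θ _ =>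
    HasDerivAt.const_mul (c θ) (hasLineDerivAt_reluDeriv h i θ x)

theorem continuous_ridge {d : ℕ} (θ : Param d) : Continuous fun x : EuclideanSpace ℝ (Fin d) =>
    inner ℝ (θ.1 : EuclideanSpace ℝ (Fin d)) x + (θ.2 : ℝ) := by fun_prop

theorem locallyIntegrable_reluDeriv {d : ℕ} (k : ℕ) (α : Fin d → ℕ) (θ : Param d) :
    LocallyIntegrable (reluDeriv k α θ) := by
  have h : reluDeriv k α θ = derivFactor k α θ • fun x =>
      relu (k - order α) (inner ℝ (θ.1 : EuclideanSpace ℝ (Fin d)) x + (θ.2 : ℝ)) := by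
    funext x
    simp [reluDeriv_eq]
  rw [h]
  exact (locallyIntegrable_relu_comp volume _ (continuous_ridge θ)).smul _

theorem locallyIntegrable_reluSum {d : ℕ} (k : ℕ) (S : Finset (Param d)) (c : Param d → ℝ)
    (α : Fin d → ℕ) : LocallyIntegrable (reluSum k S c α) :=
  locallyIntegrable_finsetSum _ fun θ _ => (locallyIntegrable_reluDeriv k α θ).smul (c θ)

theorem integral_reluSum_mul {d : ℕ} (k : ℕ) (S : Finset (Param d)) (c : Param d → ℝ)
    (α : Fin d → ℕ) {ψ : EuclideanSpace ℝ (Fin d) → ℝ} (hψ : Continuous ψ)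
    (hc : HasCompactSupport ψ) :
    ∫ x, reluSum k S c α x * ψ x = ∑ θ ∈ S, c θ * ∫ x, reluDeriv k α θ x * ψ x := by
  simp only [reluSum, Finset.sum_mul, mul_assoc]
  rw [integral_finsetSum]
  · simp only [integral_const_mul]
  · intro θ _
    exact ((locallyIntegrable_reluDeriv k α θ).integrable_smul_right_of_hasCompactSupport
      hψ hc).const_mul (c θ)

theorem integral_reluSum_mul_pderiv {d k : ℕ} (S : Finset (Param d)) (c : Param d → ℝ)
    {α : Fin d → ℕ} (h : order α < k) (i : Fin d) (ψ : EuclideanSpace ℝ (Fin d) → ℝ)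
    (hψ : ContDiff ℝ ∞ ψ) (hc : HasCompactSupport ψ) :
    ∫ x, reluSum k S c α x * pderiv i ψ x =
      -∫ x, reluSum k S c (α + Pi.single i 1) x * ψ x := by
  rw [integral_reluSum_mul k S c α (contDiff_pderiv i hψ).continuous
    (hasCompactSupport_pderiv i hψ hc), integral_reluSum_mul k S c _ hψ.continuous hc,
    ← Finset.sum_neg_distrib]
  refine Finset.sum_congr rfl fun θ _ => ?_
  obtain ⟨m, hm⟩ : ∃ m, k - order α = m + 1 := ⟨k - order α - 1, by omega⟩
  have hw : (θ.1 : EuclideanSpace ℝ (Fin d)) ≠ 0 := ne_zero_of_mem_unit_sphere θ.1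
  have h1 := integral_relu_inner_mul_lineDeriv m (θ.1 : EuclideanSpace ℝ (Fin d)) hw (θ.2 : ℝ)
    (EuclideanSpace.single i 1) ψ hψ hc
  rw [← mul_neg]
  congr 1
  simp only [reluDeriv_eq, derivFactor_add_single hm, order_add, order_single, hm,
    show k - (order α + 1) = m by omega, mul_assoc]
  rw [integral_const_mul, integral_const_mul, ← mul_neg]
  unfold pderiv
  rw [h1]
  congr 2
  refine integral_congr_ae (Filter.Eventually.of_forall fun x => ?_)
  simp only [inner_single_right]
  ring

theorem isWeakDeriv_reluSum {d k : ℕ} (S : Finset (Param d)) (c : Param d → ℝ)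
    {α : Fin d → ℕ} (h : order α ≤ k) :
    IsWeakDeriv α (reluSum k S c 0) (reluSum k S c α) :=
  ⟨locallyIntegrable_reluSum k S c 0, locallyIntegrable_reluSum k S c α, fun φ hφ hc =>
    integral_mul_multiDeriv (reluSum k S c)
      (fun _ i hγ ψ hψ hψc => integral_reluSum_mul_pderiv S c hγ i ψ hψ hψc) α h φ hφ hc⟩

theorem multiDeriv_reluSum {d k : ℕ} (S : Finset (Param d)) (c : Param d → ℝ)
    {α : Fin d → ℕ} (h : order α < k ∨ order α = 0) :
    multiDeriv α (reluSum k S c 0) = reluSum k S c α := by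
  rcases h with h | h
  · exact multiDeriv_eq_of_pderiv (reluSum k S c) (fun _ i hγ => pderiv_reluSum S c hγ i) α h
  · have hα : α = 0 := by
      funext i
      have : ∀ i, α i = 0 := by simpa [order] using h
      exact this i
    rw [multiDeriv_of_order_eq_zero h, hα]

theorem contDiff_reluSum {d k m : ℕ} (S : Finset (Param d)) (c : Param d → ℝ) (h : m < k) :
    ContDiff ℝ (m : ℕ∞) (reluSum k S c 0) := by
  unfold reluSum
  refine ContDiff.sum fun θ _ => contDiff_const.mul ?_
  obtain ⟨l, rfl⟩ : ∃ l, k = l + 1 := ⟨k - 1, by omega⟩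
  have h1 : ContDiff ℝ (m : ℕ∞) (relu (l + 1)) :=
    (contDiff_relu_succ l).of_le (by exact_mod_cast (show m ≤ l by omega))
  have h2 : ContDiff ℝ (m : ℕ∞) fun x : EuclideanSpace ℝ (Fin d) =>
      inner ℝ (θ.1 : EuclideanSpace ℝ (Fin d)) x + (θ.2 : ℝ) :=
    (innerSL ℝ (θ.1 : EuclideanSpace ℝ (Fin d))).contDiff.add contDiff_const
  simp only [funext (reluDeriv_zero (l + 1) θ)]
  exact h1.comp h2

/-- The increment of a derivative of order less than `k` along a segment is controlled by the
derivatives of the next order. -/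
theorem abs_reluSum_sub_le {d k : ℕ} (S : Finset (Param d)) (c : Param d → ℝ) {α : Fin d → ℕ}
    (hα : order α < k) {x y : EuclideanSpace ℝ (Fin d)} {K : Set (EuclideanSpace ℝ (Fin d))}
    (hK : Convex ℝ K) (hx : x ∈ K) (hy : y ∈ K) {h E : ℝ} (hxy : ∀ i, |y i - x i| ≤ h)
    (hE : ∀ z ∈ K, ∀ i, |reluSum k S c (α + Pi.single i 1) z| ≤ E) :
    |reluSum k S c α y - reluSum k S c α x| ≤ d * h * E := by
  obtain ⟨m, hm⟩ : ∃ m, k - order α = m + 1 := ⟨k - order α - 1, by omega⟩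
  have hθ : ∀ (θ : Param d) (z : EuclideanSpace ℝ (Fin d)),
      ∑ i, (y - x) i * reluDeriv k (α + Pi.single i 1) θ z = derivFactor k α θ *
      ((m + 1) * relu m (inner ℝ (θ.1 : EuclideanSpace ℝ (Fin d)) z + (θ.2 : ℝ)) *
        inner ℝ (θ.1 : EuclideanSpace ℝ (Fin d)) (y - x)) := by
    intro θ z
    have h1 : inner ℝ (θ.1 : EuclideanSpace ℝ (Fin d)) (y - x) =
        ∑ i, (y - x) i * (θ.1 : EuclideanSpace ℝ (Fin d)) i := by
      simp [PiLp.inner_apply]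
    rw [h1, Finset.mul_sum, Finset.mul_sum]
    refine Finset.sum_congr rfl fun i _ => ?_
    rw [reluDeriv_eq, derivFactor_add_single hm, order_add, order_single,
      show k - (order α + 1) = m by omega]
    ring
  have hint : reluSum k S c α y - reluSum k S c α x =
      ∫ t in (0 : ℝ)..1, ∑ i, (y - x) i * reluSum k S c (α + Pi.single i 1) (x + t • (y - x)) := by
    have h1 : ∀ z, ∑ i, (y - x) i * reluSum k S c (α + Pi.single i 1) z =
        ∑ θ ∈ S, c θ * (derivFactor k α θ *
          ((m + 1) * relu m (inner ℝ (θ.1 : EuclideanSpace ℝ (Fin d)) z + (θ.2 : ℝ)) *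
          inner ℝ (θ.1 : EuclideanSpace ℝ (Fin d)) (y - x))) := by
      intro z
      simp only [← hθ, reluSum, Finset.mul_sum]
      rw [Finset.sum_comm]
      exact Finset.sum_congr rfl fun θ _ => Finset.sum_congr rfl fun i _ => by ring
    simp only [h1]
    rw [intervalIntegral.integral_finsetSum]
    · unfold reluSum
      rw [← Finset.sum_sub_distrib]
      refine Finset.sum_congr rfl fun θ _ => ?_
      rw [intervalIntegral.integral_const_mul, intervalIntegral.integral_const_mul,
        (integral_relu_inner_segment m (θ.1 : EuclideanSpace ℝ (Fin d)) (θ.2 : ℝ) x (y - x)).2,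
        reluDeriv_eq, reluDeriv_eq, hm, add_sub_cancel]
      ring
    · intro θ _
      exact ((((integral_relu_inner_segment m (θ.1 : EuclideanSpace ℝ (Fin d)) (θ.2 : ℝ) x
        (y - x)).1.const_mul _).mul_const _).const_mul _).const_mul _
  rw [hint]
  have hb := intervalIntegral.norm_integral_le_of_norm_le_const (a := (0 : ℝ)) (b := 1)
    (C := d * h * E) (f := fun t : ℝ =>
      ∑ i, (y - x) i * reluSum k S c (α + Pi.single i 1) (x + t • (y - x))) fun t ht => by
    rw [Set.uIoc_of_le zero_le_one] at ht
    have hz : x + t • (y - x) ∈ K := hK.add_smul_sub_mem hx hy ⟨ht.1.le, ht.2⟩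
    calc ‖∑ i, (y - x) i * reluSum k S c (α + Pi.single i 1) (x + t • (y - x))‖
        ≤ ∑ i, ‖(y - x) i * reluSum k S c (α + Pi.single i 1) (x + t • (y - x))‖ :=
          norm_sum_le _ _
      _ ≤ ∑ _i : Fin d, h * E := by
          refine Finset.sum_le_sum fun i _ => ?_
          rw [norm_mul, Real.norm_eq_abs, Real.norm_eq_abs]
          exact mul_le_mul (hxy i) (hE _ hz i) (abs_nonneg _) ((abs_nonneg _).trans (hxy i))
      _ = d * h * E := by simp; ring
  simpa using hb

/-- If the derivatives of order less than `k` vanish on a net of mesh `h`, then they are controlled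
by the derivatives of order `k`. -/
theorem abs_reluSum_le_of_net {d k : ℕ} (S : Finset (Param d)) (c : Param d → ℝ)
    {K : Set (EuclideanSpace ℝ (Fin d))} (hK : Convex ℝ K) {h E : ℝ}
    (hnet : ∀ y ∈ K, ∃ x ∈ K, (∀ i, |y i - x i| ≤ h) ∧
      ∀ α : Fin d → ℕ, order α < k → reluSum k S c α x = 0)
    (hE : ∀ β : Fin d → ℕ, order β = k → ∀ x ∈ K, |reluSum k S c β x| ≤ E) :
    ∀ (m : ℕ) (α : Fin d → ℕ), order α + m = k → ∀ x ∈ K,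
      |reluSum k S c α x| ≤ (d * h) ^ m * E := by
  intro m
  induction m with
  | zero =>
    intro α hα x hx
    simpa using hE α (by simpa using hα) x hx
  | succ m ih =>
    intro α hα y hy
    obtain ⟨x, hx, hxy, hzero⟩ := hnet y hy
    have h1 := abs_reluSum_sub_le S c (show order α < k by omega) hK hx hy hxy
      (fun z hz i => ih (α + Pi.single i 1) (by rw [order_add, order_single]; omega) z hz)
    rw [hzero α (by omega), sub_zero] at h1
    rw [pow_succ']
    linarith

/-! ### Sparsification of finite ridge sums -/

/-- The unit ball has a net of mesh `2 / q`, in the coordinatewise sense, with at most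
`(q + 1) ^ d` points. -/
theorem exists_grid_net (d q : ℕ) (hq : 1 ≤ q) :
    ∃ Z : Finset (EuclideanSpace ℝ (Fin d)), Z.card ≤ (q + 1) ^ d ∧
      (∀ z ∈ Z, z ∈ Metric.closedBall (0 : EuclideanSpace ℝ (Fin d)) 1) ∧
      ∀ y ∈ Metric.closedBall (0 : EuclideanSpace ℝ (Fin d)) 1, ∃ z ∈ Z, ∀ i,
        |y i - z i| ≤ 2 / q := by
  classical
  have hqR : (0 : ℝ) < q := by exact_mod_cast hq
  set K := Metric.closedBall (0 : EuclideanSpace ℝ (Fin d)) 1 with hK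
  have hcoord : ∀ y ∈ K, ∀ i, |y i| ≤ 1 := fun y hy i => by
    have h1 := PiLp.norm_apply_le y i
    rw [hK, mem_closedBall_zero_iff] at hy
    exact h1.trans hy
  let cell : EuclideanSpace ℝ (Fin d) → Fin d → ℕ := fun y i => ⌊(y i + 1) * q / 2⌋₊
  have hcell : ∀ y ∈ K, ∀ i, cell y i < q + 1 := fun y hy i => by
    have h1 := (abs_le.1 (hcoord y hy i)).2
    refine Nat.lt_succ_of_le (Nat.floor_le_of_le ?_)
    nlinarith
  have hrep : ∀ c : Fin d → Fin (q + 1), ∃ z ∈ K, ∀ y ∈ K, (∀ i, cell y i = c i) →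
      ∀ i, cell z i = c i := fun c => by
    by_cases h : ∃ y ∈ K, ∀ i, cell y i = c i
    · obtain ⟨z, hz, hzc⟩ := h
      exact ⟨z, hz, fun _ _ _ => hzc⟩
    · exact ⟨0, by simp [hK], fun y hy hyc => absurd ⟨y, hy, hyc⟩ h⟩
  choose z hzK hz using hrep
  refine ⟨Finset.univ.image z, ?_, fun w hw => ?_, fun y hy => ?_⟩
  · refine Finset.card_image_le.trans ?_
    simp
  · obtain ⟨c, -, rfl⟩ := Finset.mem_image.1 hw
    exact hzK c
  · set c : Fin d → Fin (q + 1) := fun i => ⟨cell y i, hcell y hy i⟩ with hc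
    refine ⟨z c, Finset.mem_image_of_mem _ (Finset.mem_univ _), fun i => ?_⟩
    have h1 : cell (z c) i = cell y i := hz c y hy (fun _ => rfl) i
    have hy1 := (abs_le.1 (hcoord y hy i)).1
    have hz1 := (abs_le.1 (hcoord (z c) (hzK c) i)).1
    have a1 := Nat.floor_le (show (0 : ℝ) ≤ (y i + 1) * q / 2 by
      have : 0 ≤ y i + 1 := by linarith
      positivity)
    have a2 := Nat.lt_floor_add_one ((y i + 1) * q / 2)
    have b1 := Nat.floor_le (show (0 : ℝ) ≤ ((z c) i + 1) * q / 2 by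
      have : 0 ≤ (z c) i + 1 := by linarith
      positivity)
    have b2 := Nat.lt_floor_add_one (((z c) i + 1) * q / 2)
    have h1' : (⌊((z c) i + 1) * q / 2⌋₊ : ℝ) = ⌊(y i + 1) * q / 2⌋₊ :=
      congrArg (Nat.cast : ℕ → ℝ) h1
    rw [h1'] at b1 b2
    rw [abs_le, le_div_iff₀ hqR, ← neg_div, div_le_iff₀ hqR]
    constructor <;> linarith

theorem abs_prod_coord_le_one {d : ℕ} (α : Fin d → ℕ) (θ : Param d) :
    |∏ i, (θ.1 : EuclideanSpace ℝ (Fin d)) i ^ α i| ≤ 1 := by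
  rw [Finset.abs_prod]
  refine Finset.prod_le_one (fun i _ => abs_nonneg _) fun i _ => ?_
  rw [abs_pow]
  exact pow_le_one₀ (abs_nonneg _) (abs_coord_le_one θ.1 i)

theorem abs_reluDeriv_le {d k : ℕ} (α : Fin d → ℕ) (θ : Param d)
    {x : EuclideanSpace ℝ (Fin d)} (hx : x ∈ Metric.closedBall (0 : EuclideanSpace ℝ (Fin d)) 1) :
    |reluDeriv k α θ x| ≤ k.factorial * 2 ^ k := by
  have h1 : |inner ℝ (θ.1 : EuclideanSpace ℝ (Fin d)) x + (θ.2 : ℝ)| ≤ 2 := by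
    have h2 : |inner ℝ (θ.1 : EuclideanSpace ℝ (Fin d)) x| ≤ 1 := by
      refine (abs_real_inner_le_norm _ _).trans ?_
      rw [norm_eq_of_mem_sphere, one_mul]
      simpa using hx
    have h3 : |(θ.2 : ℝ)| ≤ 1 := abs_le.2 θ.2.2
    exact (abs_add_le _ _).trans (by linarith)
  have h4 : |relu (k - order α) (inner ℝ (θ.1 : EuclideanSpace ℝ (Fin d)) x + (θ.2 : ℝ))| ≤
      2 ^ k := by
    calc _ ≤ |inner ℝ (θ.1 : EuclideanSpace ℝ (Fin d)) x + (θ.2 : ℝ)| ^ (k - order α) :=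
          abs_relu_le _ _
      _ ≤ 2 ^ (k - order α) := by gcongr
      _ ≤ 2 ^ k := pow_le_pow_right₀ (by norm_num) (Nat.sub_le _ _)
  have h5 : (k.descFactorial (order α) : ℝ) ≤ k.factorial := by
    rcases le_or_gt (order α) k with h | h
    · rw [← Nat.factorial_mul_descFactorial h]
      exact_mod_cast Nat.le_mul_of_pos_left _ (Nat.factorial_pos _)
    · rw [Nat.descFactorial_eq_zero_iff_lt.2 h]; simp
  unfold reluDeriv
  rw [abs_mul, abs_mul, Nat.abs_cast]
  calc _ ≤ (k.factorial : ℝ) * 2 ^ k * 1 := by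
        gcongr
        exact abs_prod_coord_le_one α θ
    _ = _ := mul_one _

theorem reluDeriv_of_order_eq {d k : ℕ} {β : Fin d → ℕ} (hβ : order β = k) (θ : Param d)
    (x : EuclideanSpace ℝ (Fin d)) :
    reluDeriv k β θ x = k.factorial * ((∏ i, (θ.1 : EuclideanSpace ℝ (Fin d)) i ^ β i) *
      if decide (0 ≤ inner ℝ (θ.1 : EuclideanSpace ℝ (Fin d)) x + (θ.2 : ℝ)) = true
        then 1 else 0) := by
  simp only [reluDeriv, hβ, Nat.descFactorial_self, Nat.sub_self, relu, pow_zero,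
    decide_eq_true_eq]
  ring

/-- Multi-indices of order at most `k` have entries at most `k`. -/
theorem exists_fin_multiindex {d k : ℕ} {α : Fin d → ℕ} (h : order α ≤ k) :
    ∃ γ : Fin d → Fin (k + 1), (fun i => (γ i : ℕ)) = α :=
  ⟨fun i => ⟨α i, Nat.lt_succ_of_le
    ((Finset.single_le_sum (fun _ _ => Nat.zero_le _) (Finset.mem_univ i)).trans h)⟩, rfl⟩

/-- One coloring step, with the resolution `q` as a parameter. The derivatives of order less than
`k` are made to vanish on a grid of mesh `2 / q`, and those of order `k`, which are weighted sums
over sign patterns of affine functions, are bounded by the discrepancy estimate. -/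
theorem exists_coloring_of_resolution {d k q N : ℕ} (hd : 1 ≤ d) (hq : 1 ≤ q) (hN : 1 ≤ N)
    (L : Finset (Param d)) (hLN : L.card ≤ N)
    (hqL : 32 * (k + 1) ^ d * (4 * d * q) ^ d ≤ L.card) (a : Param d → ℝ)
    (ha : ∀ θ ∈ L, |a θ| ≤ 2 / N) :
    ∃ x : Param d → ℝ, (∀ θ, |x θ| ≤ 1) ∧ (∀ θ ∉ L, x θ = 0) ∧ ∑ θ ∈ L, a θ * x θ = 0 ∧
      L.card ≤ 4 * (L.filter fun θ => |x θ| = 1).card ∧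
      ∀ α : Fin d → ℕ, order α ≤ k →
        ∀ y ∈ Metric.closedBall (0 : EuclideanSpace ℝ (Fin d)) 1,
          |reluSum k L (fun θ => a θ * x θ) α y| ≤
            (d * (2 / q)) ^ (k - order α) *
              (k.factorial * (2 / N) * ((16 * d + 36) * √(N / q))) := by
  classical
  have hNR : (0 : ℝ) < N := by exact_mod_cast hN
  obtain ⟨Z, hZcard, hZK, hZ⟩ := exists_grid_net d q hq
  let A := Fin d → Fin (k + 1)
  let ev : A → Fin d → ℕ := fun γ i => γ i
  have hAcard : Fintype.card A = (k + 1) ^ d := by simp [A]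
  have hF : VCDimLE (Set.range fun (x : EuclideanSpace ℝ (Fin d)) (θ : L) =>
      decide (0 ≤ inner ℝ (θ.1.1 : EuclideanSpace ℝ (Fin d)) x + (θ.1.2 : ℝ))) d := by
    have := vcDimLE_affine (fun θ : L => (θ.1.1 : EuclideanSpace ℝ (Fin d)))
      (fun θ : L => (θ.1.2 : ℝ))
    rwa [finrank_euclideanSpace, Fintype.card_fin] at this
  have hpos : 1 ≤ (k + 1) ^ d * (4 * d * q) ^ d := Nat.mul_pos (by positivity) (by positivity)
  have hcard : 8 * (Fintype.card (Option (Z × A)) +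
      Fintype.card A * (2 * (4 * d * q) ^ d)) ≤ Fintype.card L := by
    rw [Fintype.card_option, Fintype.card_prod, hAcard, Fintype.card_coe, Fintype.card_coe]
    have h1 : Z.card ≤ (4 * d * q) ^ d :=
      hZcard.trans (Nat.pow_le_pow_left (by nlinarith) d)
    have h2 : Z.card * (k + 1) ^ d ≤ (k + 1) ^ d * (4 * d * q) ^ d := by
      rw [mul_comm]; exact Nat.mul_le_mul_left _ h1
    nlinarith
  have hLpos : 0 < Fintype.card L := by
    rw [Fintype.card_coe]
    nlinarith
  obtain ⟨x, hx1, hxu, hxF, hxc⟩ := exists_partial_coloring_of_vcDimLE hd hq _ hF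
    (fun (β : A) (θ : L) => a θ.1 * (N / 2) *
      ∏ i, (θ.1.1 : EuclideanSpace ℝ (Fin d)) i ^ ev β i)
    (fun β θ => by
      rw [abs_mul, abs_mul, abs_of_pos (show (0 : ℝ) < N / 2 by positivity)]
      have h1 := ha θ.1 θ.2
      have h2 := abs_prod_coord_le_one (ev β) θ.1
      have h3 : |a θ.1| * (N / 2) ≤ 1 := by
        calc |a θ.1| * (N / 2) ≤ 2 / N * (N / 2) := by gcongr
          _ = 1 := by field_simp
      exact mul_le_one₀ h3 (abs_nonneg _) h2)
    (fun (o : Option (Z × A)) (θ : L) =>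
      o.elim (a θ.1) fun zγ => a θ.1 * reluDeriv k (ev zγ.2) θ.1 zγ.1) hLpos hcard
  let x' : Param d → ℝ := fun θ => if h : θ ∈ L then x ⟨θ, h⟩ else 0
  have hx' : ∀ θ : L, x' θ.1 = x θ := fun θ => by simp [x']
  have hsum : ∀ f : Param d → ℝ, ∑ θ ∈ L, f θ * x' θ = ∑ θ : L, f θ.1 * x θ := fun f => by
    rw [← Finset.sum_coe_sort]
    exact Finset.sum_congr rfl fun θ _ => by rw [hx']
  have hrsum : ∀ α y, reluSum k L (fun θ => a θ * x' θ) α y =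
      ∑ θ : L, a θ.1 * reluDeriv k α θ.1 y * x θ := fun α y => by
    rw [← hsum fun θ => a θ * reluDeriv k α θ y]
    exact Finset.sum_congr rfl fun θ _ => by ring
  refine ⟨x', fun θ => ?_, fun θ hθ => by simp [x', hθ], ?_, ?_, fun α hα y hy => ?_⟩
  · by_cases h : θ ∈ L
    · rw [hx' ⟨θ, h⟩]; exact hx1 _
    · simp [x', h]
  · rw [hsum]; exact hxu none
  · rw [Fintype.card_coe] at hxc
    refine hxc.trans (Nat.mul_le_mul_left _ ?_)
    rw [← Finset.card_map (Function.Embedding.subtype _)]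
    refine Finset.card_le_card fun θ hθ => ?_
    obtain ⟨θ', hθ', rfl⟩ := Finset.mem_map.1 hθ
    rw [Finset.mem_filter] at hθ' ⊢
    refine ⟨θ'.2, ?_⟩
    simpa [hx'] using hθ'.2
  · refine abs_reluSum_le_of_net L (fun θ => a θ * x' θ) (convex_closedBall 0 1) (fun w hw => ?_)
      (fun β hβ w _ => ?_) (k - order α) α (by omega) y hy
    · obtain ⟨z, hzZ, hzw⟩ := hZ w hw
      refine ⟨z, hZK z hzZ, hzw, fun β hβ => ?_⟩
      obtain ⟨γ, rfl⟩ := exists_fin_multiindex hβ.le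
      rw [hrsum]
      exact hxu (some (⟨z, hzZ⟩, γ))
    · obtain ⟨γ, rfl⟩ := exists_fin_multiindex hβ.le
      have h1 := hxF _ ⟨w, rfl⟩ γ
      have h2 : reluSum k L (fun θ => a θ * x' θ) (fun i => (γ i : ℕ)) w =
          k.factorial * (2 / N) * ∑ θ : L, a θ.1 * (N / 2) *
            (∏ i, (θ.1.1 : EuclideanSpace ℝ (Fin d)) i ^ ev γ i) *
            (if decide (0 ≤ inner ℝ (θ.1.1 : EuclideanSpace ℝ (Fin d)) w + (θ.1.2 : ℝ)) = true
              then 1 else 0) * x θ := by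
        rw [hrsum, Finset.mul_sum]
        refine Finset.sum_congr rfl fun θ _ => ?_
        rw [reluDeriv_of_order_eq hβ]
        field_simp
        simp only [ev]
        ring
      rw [h2, abs_mul, abs_of_pos (show (0 : ℝ) < k.factorial * (2 / N) by positivity)]
      refine mul_le_mul_of_nonneg_left (h1.trans ?_) (by positivity)
      gcongr
      rw [Fintype.card_coe]
      exact hLN

/-- The coloring step with the resolution `q ≈ N ^ (1 / d)`, after a choice of sign by which many
of the extreme entries equal `-1`. -/
theorem exists_coloring (d k : ℕ) (hd : 1 ≤ d) : ∃ (C : ℝ) (κ : ℕ), 0 ≤ C ∧ 1 ≤ κ ∧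
    ∀ (N : ℕ), κ ≤ N → ∀ (L : Finset (Param d)), L.card ≤ N → N ≤ 2 * L.card →
    ∀ a : Param d → ℝ, (∀ θ ∈ L, |a θ| ≤ 2 / N) →
    ∃ x : Param d → ℝ, (∀ θ, |x θ| ≤ 1) ∧ (∀ θ ∉ L, x θ = 0) ∧ ∑ θ ∈ L, a θ * x θ = 0 ∧
      N ≤ 16 * (L.filter fun θ => x θ = -1).card ∧
      ∀ α : Fin d → ℕ, order α ≤ k →
        ∀ y ∈ Metric.closedBall (0 : EuclideanSpace ℝ (Fin d)) 1,
          |reluSum k L (fun θ => a θ * x θ) α y| ≤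
            C * (N : ℝ) ^ (-(1 / 2 : ℝ) - (2 * ((k : ℝ) - (order α : ℝ)) + 1) / (2 * (d : ℝ))) := by
  set κ : ℕ := 64 * (k + 1) ^ d * (4 * d) ^ d with hκ
  have hκ1 : 1 ≤ κ := Nat.mul_pos (by positivity) (by positivity)
  have hκR : (1 : ℝ) ≤ κ := by exact_mod_cast hκ1
  have hdR : (1 : ℝ) ≤ d := by exact_mod_cast hd
  set K : ℝ := 2 * (κ : ℝ) ^ (1 / (d : ℝ)) with hK
  have hK1 : 1 ≤ K := by
    have := Real.one_le_rpow hκR (show (0 : ℝ) ≤ 1 / d by positivity)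
    linarith
  refine ⟨(2 * d * K) ^ k * (k.factorial * (2 * (16 * d + 36) * √K)), κ, by positivity, hκ1,
    fun N hN L hLN hNL a ha => ?_⟩
  have hN1 : 1 ≤ N := hκ1.trans hN
  have hNR : (0 : ℝ) < N := by exact_mod_cast hN1
  set ρ : ℝ := ((N : ℝ) / κ) ^ (1 / (d : ℝ)) with hρ
  have hρ1 : 1 ≤ ρ := by
    refine Real.one_le_rpow ?_ (by positivity)
    rw [le_div_iff₀ (by positivity), one_mul]
    exact_mod_cast hN
  set q := ⌊ρ⌋₊ with hq_def
  have hq : 1 ≤ q := (Nat.one_le_floor_iff _).2 hρ1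
  have hqR : (0 : ℝ) < q := by exact_mod_cast hq
  have hqρ : (q : ℝ) ≤ ρ := Nat.floor_le (by linarith)
  have hqL : 32 * (k + 1) ^ d * (4 * d * q) ^ d ≤ L.card := by
    have h1 : (q : ℝ) ^ d ≤ N / κ := by
      calc (q : ℝ) ^ d ≤ ρ ^ d := by gcongr
        _ = N / κ := by
          rw [hρ, one_div, Real.rpow_inv_natCast_pow (by positivity) (by omega)]
    rw [le_div_iff₀ (by positivity)] at h1
    have h2 : q ^ d * κ ≤ N := by exact_mod_cast h1
    have h3 : q ^ d * κ = 2 * (32 * (k + 1) ^ d * (4 * d * q) ^ d) := by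
      rw [hκ, mul_pow (4 * d) q]; ring
    omega
  -- the resolution in terms of `N`
  have hqinv : 1 / (q : ℝ) ≤ K * (N : ℝ) ^ (-(1 / (d : ℝ))) := by
    have h1 : ρ ≤ 2 * q := by
      have h2 : ρ < q + 1 := Nat.lt_floor_add_one ρ
      have h3 : (1 : ℝ) ≤ q := by exact_mod_cast hq
      linarith
    have h4 : K * (N : ℝ) ^ (-(1 / (d : ℝ))) = 2 / ρ := by
      rw [hK, hρ, Real.div_rpow hNR.le (by positivity), Real.rpow_neg hNR.le]
      field_simp
    rw [h4, div_le_div_iff₀ hqR (by linarith)]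
    linarith
  obtain ⟨x, hx1, hxL, hxa, hxc, hxb⟩ := exists_coloring_of_resolution (k := k) hd hq hN1 L hLN
    hqL a ha
  have hbound : ∀ α : Fin d → ℕ, order α ≤ k →
      ∀ y ∈ Metric.closedBall (0 : EuclideanSpace ℝ (Fin d)) 1,
        |reluSum k L (fun θ => a θ * x θ) α y| ≤
          (2 * d * K) ^ k * (k.factorial * (2 * (16 * d + 36) * √K)) *
          (N : ℝ) ^ (-(1 / 2 : ℝ) - (2 * ((k : ℝ) - (order α : ℝ)) + 1) / (2 * (d : ℝ))) := by
    intro α hα y hy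
    refine (hxb α hα y hy).trans ?_
    set m := k - order α with hm
    have hmR : (k : ℝ) - (order α : ℝ) = m := by rw [hm, Nat.cast_sub hα]
    set η : ℝ := (N : ℝ) ^ (-(1 / (d : ℝ))) with hη
    have hη0 : 0 < η := Real.rpow_pos_of_pos hNR _
    have h1 : (d * (2 / (q : ℝ))) ^ m ≤ (2 * d * K) ^ k * η ^ m := by
      calc (d * (2 / (q : ℝ))) ^ m = (2 * d * (1 / q)) ^ m := by ring
        _ ≤ (2 * d * (K * η)) ^ m := by gcongr
        _ = (2 * d * K) ^ m * η ^ m := by rw [← mul_pow]; ring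
        _ ≤ (2 * d * K) ^ k * η ^ m := by
          gcongr
          · nlinarith
          · omega
    have h2 : √(N / q) ≤ √N * (√K * √η) := by
      rw [← Real.sqrt_mul (by positivity), ← Real.sqrt_mul (by positivity), div_eq_mul_one_div]
      gcongr
    have h3 : (N : ℝ) ^ (-(1 / 2 : ℝ) - (2 * (m : ℝ) + 1) / (2 * (d : ℝ))) =
        η ^ m * (√η * (√N / N)) := by
      rw [Real.sqrt_eq_rpow, Real.sqrt_eq_rpow, hη, ← Real.rpow_natCast, ← Real.rpow_mul hNR.le,
        ← Real.rpow_mul hNR.le, ← Real.rpow_sub_one hNR.ne', ← Real.rpow_add hNR,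
        ← Real.rpow_add hNR]
      congr 1
      field_simp
      ring
    rw [hmR, h3]
    calc (d * (2 / (q : ℝ))) ^ m * (k.factorial * (2 / N) * ((16 * d + 36) * √(N / q)))
        ≤ ((2 * d * K) ^ k * η ^ m) *
          (k.factorial * (2 / N) * ((16 * d + 36) * (√N * (√K * √η)))) := by gcongr
      _ = _ := by ring
  by_cases hsign : N ≤ 16 * (L.filter fun θ => x θ = -1).card
  · exact ⟨x, hx1, hxL, hxa, hsign, hbound⟩
  · refine ⟨fun θ => -x θ, fun θ => by rw [abs_neg]; exact hx1 θ, fun θ hθ => by simp [hxL θ hθ],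
      by simpa using hxa, ?_, fun α hα y hy => ?_⟩
    · have h1 : (L.filter fun θ => |x θ| = 1).card ≤
          (L.filter fun θ => x θ = -1).card + (L.filter fun θ => -x θ = -1).card := by
        classical
        refine (Finset.card_le_card fun θ hθ => ?_).trans (Finset.card_union_le _ _)
        rw [Finset.mem_filter] at hθ
        rw [Finset.mem_union, Finset.mem_filter, Finset.mem_filter]
        rcases (abs_eq zero_le_one).1 hθ.2 with h | h
        · exact Or.inr ⟨hθ.1, by rw [h]⟩
        · exact Or.inl ⟨hθ.1, h⟩
      change N ≤ 16 * (L.filter fun θ => -x θ = -1).card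
      omega
    · have h1 : reluSum k L (fun θ => a θ * -x θ) α y =
          -reluSum k L (fun θ => a θ * x θ) α y := by
        simp [reluSum]
      rw [h1, abs_neg]
      exact hbound α hα y hy

/-! ### Finitely supported measures -/

theorem integral_eq_sum_of_supportedOn {X : Type*} [MeasurableSpace X] [MeasurableSingletonClass X]
    {τ : Measure X} [IsFiniteMeasure τ] {S : Finset X} (h : SupportedOn τ S) (f : X → ℝ) :
    ∫ θ, f θ ∂τ = ∑ θ ∈ S, τ.real {θ} * f θ := by
  have h1 : τ.restrict (S : Set X) = τ :=
    Measure.restrict_eq_self_of_ae_mem (measure_eq_zero_iff_ae_notMem.1 h |>.mono fun x hx => by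
      simpa using hx)
  have h2 : IntegrableOn f (S : Set X) τ := by
    have h3 := (integrableOn_finset_iUnion (f := f) (μ := τ) (s := S) (t := fun x => {x})).2
      fun x _ => integrableOn_singleton (by simp) (measure_lt_top _ _)
    rwa [← Finset.set_biUnion_coe, Set.biUnion_of_singleton] at h3
  calc ∫ θ, f θ ∂τ = ∫ θ in (S : Set X), f θ ∂τ := by rw [h1]
    _ = _ := by rw [setIntegral_finset S h2]; rfl

/-- The measure with weights `b` on the points of `S`. -/
noncomputable def weightedDirac {X : Type*} [MeasurableSpace X] (S : Finset X) (b : X → ℝ) :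
    Measure X :=
  ∑ θ ∈ S, ENNReal.ofReal (b θ) • Measure.dirac θ

theorem isProbabilityMeasure_weightedDirac {X : Type*} [MeasurableSpace X] {S : Finset X}
    {b : X → ℝ} (hb : ∀ θ ∈ S, 0 ≤ b θ) (hsum : ∑ θ ∈ S, b θ = 1) :
    IsProbabilityMeasure (weightedDirac S b) := by
  refine ⟨?_⟩
  simp only [weightedDirac, Measure.coe_finsetSum, Finset.sum_apply, Measure.smul_apply,
    measure_univ, smul_eq_mul, mul_one]
  rw [← ENNReal.ofReal_sum_of_nonneg hb, hsum, ENNReal.ofReal_one]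

theorem supportedOn_weightedDirac {X : Type*} [MeasurableSpace X] [MeasurableSingletonClass X]
    (S : Finset X) (b : X → ℝ) :
    SupportedOn (weightedDirac S b) (S.filter fun θ => b θ ≠ 0) := by
  unfold SupportedOn
  simp only [weightedDirac, Measure.coe_finsetSum, Finset.sum_apply, Measure.smul_apply,
    smul_eq_mul]
  refine Finset.sum_eq_zero fun θ hθ => ?_
  by_cases h : b θ = 0
  · simp [h]
  · rw [Measure.dirac_apply' _ (Finset.measurableSet _).compl]
    simp [hθ, h]

theorem integral_weightedDirac {X : Type*} [MeasurableSpace X] [MeasurableSingletonClass X]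
    {S : Finset X} {b : X → ℝ} (hb : ∀ θ ∈ S, 0 ≤ b θ) (f : X → ℝ) :
    ∫ θ, f θ ∂(weightedDirac S b) = ∑ θ ∈ S, b θ * f θ := by
  unfold weightedDirac
  rw [integral_finsetSum_measure]
  · refine Finset.sum_congr rfl fun θ hθ => ?_
    rw [integral_smul_measure, integral_dirac, ENNReal.toReal_ofReal (hb θ hθ), smul_eq_mul]
  · intro θ _
    exact (integrable_dirac (by simp)).smul_measure ENNReal.ofReal_ne_top

theorem sum_real_singleton_eq_one {X : Type*} [MeasurableSpace X] [MeasurableSingletonClass X]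
    {τ : Measure X} [IsProbabilityMeasure τ] {S : Finset X} (h : SupportedOn τ S) :
    ∑ θ ∈ S, τ.real {θ} = 1 := by
  have := integral_eq_sum_of_supportedOn h (fun _ => (1 : ℝ))
  simpa using this.symm

/-- Reduction to finite sums: a competitor with weights `b` on the points of `S` is determined, with
all the regularity statements, by the finite ridge sum with coefficients `τ {θ} - b θ`. -/
theorem exists_measure_of_weights {d k : ℕ} (N : ℕ)
    (τ : Measure (Param d)) [IsProbabilityMeasure τ]
    (S : Finset (Param d)) (hS : SupportedOn τ S)
    (b : Param d → ℝ) (hb : ∀ θ ∈ S, 0 ≤ b θ) (hbsum : ∑ θ ∈ S, b θ = 1)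
    (hcard : ((S.filter fun θ => b θ ≠ 0).card : ℝ) ≤ (1 - 1 / 48) * (N : ℝ)) (ε : (Fin d → ℕ) → ℝ)
    (hε : ∀ α : Fin d → ℕ, order α ≤ k → 
        ∀ x ∈ Metric.closedBall (0 : EuclideanSpace ℝ (Fin d)) 1,
      |reluSum k S (fun θ => τ.real {θ} - b θ) α x| ≤ ε α) :
    ∃ (τ' : Measure (Param d)) (T : Finset (Param d)),
        IsProbabilityMeasure τ' ∧
        SupportedOn τ' T ∧
        (T.card : ℝ) ≤ (1 - 1 / 48) * (N : ℝ) ∧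
        (∀ m : ℕ, m < k → ContDiff ℝ (m : ℕ∞)
          (fun x => reluIntegral k τ x - reluIntegral k τ' x)) ∧
        ∀ α : Fin d → ℕ, order α ≤ k →
          IsWeakDeriv α
            (fun x => reluIntegral k τ x - reluIntegral k τ' x)
            (fun x => reluIntegralDeriv k α τ x
              - reluIntegralDeriv k α τ' x) ∧
          (order α < k ∨ order α = 0 →
            ∀ x : EuclideanSpace ℝ (Fin d),
              multiDeriv α
                (fun y => reluIntegral k τ y - reluIntegral k τ' y) x
              = reluIntegralDeriv k α τ x
                - reluIntegralDeriv k α τ' x) ∧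
          ∀ x ∈ Metric.closedBall (0 : EuclideanSpace ℝ (Fin d)) 1,
            |reluIntegralDeriv k α τ x - reluIntegralDeriv k α τ' x|
              ≤ ε α := by
  have hD : ∀ α, (fun x => reluIntegralDeriv k α τ x -
      reluIntegralDeriv k α (weightedDirac S b) x) =
      reluSum k S (fun θ => τ.real {θ} - b θ) α := fun α => by
    funext x
    unfold reluIntegralDeriv reluSum
    rw [integral_eq_sum_of_supportedOn hS, integral_weightedDirac hb, ← Finset.sum_sub_distrib]
    exact Finset.sum_congr rfl fun θ _ => by ring
  have hI : ∀ μ : Measure (Param d), reluIntegral k μ = reluIntegralDeriv k 0 μ :=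
    fun μ => by
      funext x
      unfold reluIntegral reluIntegralDeriv
      simp only [reluDeriv_zero]
  refine ⟨weightedDirac S b, S.filter fun θ => b θ ≠ 0, isProbabilityMeasure_weightedDirac hb hbsum,
    supportedOn_weightedDirac S b, hcard, ?_⟩
  rw [hI, hI, hD]
  refine ⟨fun m hm => contDiff_reluSum S _ hm, fun α hα => ?_⟩
  have hDα := hD α
  refine ⟨?_, fun h x => ?_, fun x hx => ?_⟩
  · rw [hDα]; exact isWeakDeriv_reluSum S _ hα
  · rw [multiDeriv_reluSum S _ h, ← hDα]
  · rw [congrFun hDα x]; exact hε α hα x hx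

end ShallowReLU

open ShallowReLU in
theorem mainTheorem4 (d k : ℕ) (hd : 1 ≤ d) :
    ∃ C : ℝ, ∀ (N : ℕ), 6 ≤ N →
      ∀ (τ : MeasureTheory.Measure (ShallowReLU.Param d)) [MeasureTheory.IsProbabilityMeasure τ]
        (S : Finset (ShallowReLU.Param d)), S.card = N → ShallowReLU.SupportedOn τ S →
      ∃ (τ' : MeasureTheory.Measure (ShallowReLU.Param d)) (T : Finset (ShallowReLU.Param d)),
        MeasureTheory.IsProbabilityMeasure τ' ∧
        ShallowReLU.SupportedOn τ' T ∧
        (T.card : ℝ) ≤ (1 - 1 / 48) * (N : ℝ) ∧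
        -- the difference of the two integrals is of class `C^m` for every `m < k`
        (∀ m : ℕ, m < k → ContDiff ℝ (m : ℕ∞)
          (fun x => ShallowReLU.reluIntegral k τ x - ShallowReLU.reluIntegral k τ' x)) ∧
        ∀ α : Fin d → ℕ, ShallowReLU.order α ≤ k →
          -- its derivative `D^α`, in the weak sense
          ShallowReLU.IsWeakDeriv α
            (fun x => ShallowReLU.reluIntegral k τ x - ShallowReLU.reluIntegral k τ' x)
            (fun x => ShallowReLU.reluIntegralDeriv k α τ x
              - ShallowReLU.reluIntegralDeriv k α τ' x) ∧
          -- and in the classical sense, at every point, where that makes sense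
          (ShallowReLU.order α < k ∨ ShallowReLU.order α = 0 →
            ∀ x : EuclideanSpace ℝ (Fin d),
              ShallowReLU.multiDeriv α
                (fun y => ShallowReLU.reluIntegral k τ y - ShallowReLU.reluIntegral k τ' y) x
              = ShallowReLU.reluIntegralDeriv k α τ x
                - ShallowReLU.reluIntegralDeriv k α τ' x) ∧
          -- the uniform bound on the closed unit ball
          ∀ x ∈ Metric.closedBall (0 : EuclideanSpace ℝ (Fin d)) 1,
            |ShallowReLU.reluIntegralDeriv k α τ x - ShallowReLU.reluIntegralDeriv k α τ' x|
              ≤ C * (N : ℝ) ^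
                (-(1 / 2 : ℝ) - (2 * ((k : ℝ) - (ShallowReLU.order α : ℝ)) + 1) / (2 * (d : ℝ))) := by
  classical
  obtain ⟨C, κ, hC, hκ, hmain⟩ := exists_coloring d k hd
  have hκR : (1 : ℝ) ≤ κ := by exact_mod_cast hκ
  have hdR : (1 : ℝ) ≤ d := by exact_mod_cast hd
  refine ⟨C + 2 * (k.factorial * 2 ^ k) * (κ : ℝ) ^ ((k : ℝ) + 1), fun N hN τ _ S hSN hS => ?_⟩
  have hNR : (6 : ℝ) ≤ N := by exact_mod_cast hN
  have hasum := sum_real_singleton_eq_one hS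
  set a : Param d → ℝ := fun θ => τ.real {θ} with ha_def
  have ha0 : ∀ θ, 0 ≤ a θ := fun θ => MeasureTheory.measureReal_nonneg
  rcases lt_or_ge N κ with hsmall | hlarge
  · -- for bounded `N` a point mass is good enough
    obtain ⟨θ₀, hθ₀⟩ : S.Nonempty := Finset.card_pos.1 (by omega)
    have hbsum : ∑ θ ∈ S, (if θ = θ₀ then (1 : ℝ) else 0) = 1 := by simp [hθ₀]
    refine exists_measure_of_weights N τ S hS (fun θ => if θ = θ₀ then 1 else 0)
      (fun θ _ => by positivity) hbsum ?_ _ fun α hα x hx => ?_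
    · have : (S.filter fun θ => (if θ = θ₀ then (1 : ℝ) else 0) ≠ 0) ⊆ {θ₀} := fun θ hθ => by
        simpa using (Finset.mem_filter.1 hθ).2
      have h1 : ((S.filter fun θ => (if θ = θ₀ then (1 : ℝ) else 0) ≠ 0).card : ℝ) ≤ 1 := by
        exact_mod_cast Finset.card_le_card this
      linarith
    · have h1 : |reluSum k S (fun θ => τ.real {θ} - if θ = θ₀ then 1 else 0) α x| ≤
          2 * (k.factorial * 2 ^ k) := by
        calc _ ≤ ∑ θ ∈ S, |(τ.real {θ} - if θ = θ₀ then 1 else 0) * reluDeriv k α θ x| :=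
              Finset.abs_sum_le_sum_abs _ _
          _ ≤ ∑ θ ∈ S, (a θ + if θ = θ₀ then 1 else 0) * (k.factorial * 2 ^ k) := by
              refine Finset.sum_le_sum fun θ _ => ?_
              rw [abs_mul]
              have h2 : (0 : ℝ) ≤ if θ = θ₀ then 1 else 0 := by positivity
              refine mul_le_mul ?_ (abs_reluDeriv_le α θ hx) (abs_nonneg _)
                (add_nonneg (ha0 θ) h2)
              refine (abs_sub _ _).trans ?_
              rw [abs_of_nonneg h2, abs_of_nonneg (ha0 θ)]
          _ = _ := by
              rw [← Finset.sum_mul, Finset.sum_add_distrib, hasum, hbsum]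
              norm_num
      set e : ℝ := -(1 / 2 : ℝ) - (2 * ((k : ℝ) - (order α : ℝ)) + 1) / (2 * (d : ℝ)) with he
      have h2 : -((k : ℝ) + 1) ≤ e := by
        have h3 : (0 : ℝ) ≤ order α := Nat.cast_nonneg _
        have h4 : (order α : ℝ) ≤ k := by exact_mod_cast hα
        have h5 : (2 * ((k : ℝ) - (order α : ℝ)) + 1) / (2 * (d : ℝ)) ≤ (2 * k + 1) / 2 := by
          rw [div_le_div_iff₀ (by positivity) (by norm_num)]
          nlinarith
        linarith
      have h3 : (1 : ℝ) ≤ (κ : ℝ) ^ ((k : ℝ) + 1) * (N : ℝ) ^ e := by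
        have h4 : (N : ℝ) ^ ((k : ℝ) + 1) ≤ (κ : ℝ) ^ ((k : ℝ) + 1) :=
          Real.rpow_le_rpow (by linarith) (by exact_mod_cast hsmall.le) (by positivity)
        have h5 : (N : ℝ) ^ (-((k : ℝ) + 1)) ≤ (N : ℝ) ^ e :=
          Real.rpow_le_rpow_of_exponent_le (by linarith) h2
        calc (1 : ℝ) = (N : ℝ) ^ ((k : ℝ) + 1) * (N : ℝ) ^ (-((k : ℝ) + 1)) := by
              rw [← Real.rpow_add (by linarith)]; simp
          _ ≤ _ := by gcongr
      have h6 : 0 ≤ C * (N : ℝ) ^ e := mul_nonneg hC (Real.rpow_nonneg (by linarith) _)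
      have h7 : (0 : ℝ) ≤ 2 * (k.factorial * 2 ^ k) := by positivity
      calc _ ≤ 2 * ((k.factorial : ℝ) * 2 ^ k) * 1 := by rw [mul_one]; exact h1
        _ ≤ 2 * (k.factorial * 2 ^ k) * ((κ : ℝ) ^ ((k : ℝ) + 1) * (N : ℝ) ^ e) := by gcongr
        _ ≤ C * (N : ℝ) ^ e +
            2 * (k.factorial * 2 ^ k) * ((κ : ℝ) ^ ((k : ℝ) + 1) * (N : ℝ) ^ e) := by linarith
        _ = _ := by ring
  · -- the points of small mass are at least half of all points
    set L := S.filter fun θ => a θ ≤ 2 / N with hL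
    have hLS : L ⊆ S := Finset.filter_subset _ _
    have hNL : N ≤ 2 * L.card := by
      have h1 : (S.filter fun θ => ¬ a θ ≤ 2 / N).card * (2 / (N : ℝ)) ≤ 1 := by
        rw [← hasum, ← nsmul_eq_mul, ← Finset.sum_const]
        exact (Finset.sum_le_sum fun θ hθ => (not_le.1 (Finset.mem_filter.1 hθ).2).le).trans
          (Finset.sum_le_sum_of_subset_of_nonneg (Finset.filter_subset _ _) fun θ _ _ => ha0 θ)
      have h2 : (2 * (S.filter fun θ => ¬ a θ ≤ 2 / N).card : ℝ) ≤ N := by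
        rw [mul_div_assoc', div_le_one (by linarith)] at h1
        linarith
      have h3 : 2 * (S.filter fun θ => ¬ a θ ≤ 2 / N).card ≤ N := by exact_mod_cast h2
      have h4 := Finset.card_filter_add_card_filter_not (s := S) (fun θ => a θ ≤ 2 / (N : ℝ))
      rw [← hL] at h4
      omega
    obtain ⟨x, hx1, hxL, hxa, hxc, hxb⟩ := hmain N hlarge L
      ((Finset.card_le_card hLS).trans hSN.le) hNL a fun θ hθ => by
        rw [abs_of_nonneg (ha0 θ)]
        exact (Finset.mem_filter.1 hθ).2
    have hxS : ∀ f : Param d → ℝ, ∑ θ ∈ S, a θ * x θ * f θ = ∑ θ ∈ L, a θ * x θ * f θ := fun f =>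
      (Finset.sum_subset hLS fun θ _ hθ => by simp [hxL θ hθ]).symm
    refine exists_measure_of_weights N τ S hS (fun θ => a θ * (1 + x θ))
      (fun θ _ => mul_nonneg (ha0 θ) (by linarith [(abs_le.1 (hx1 θ)).1])) ?_ ?_ _
      fun α hα y hy => ?_
    · have h1 := hxS fun _ => 1
      simp only [mul_one] at h1
      simp only [mul_add, mul_one, Finset.sum_add_distrib]
      rw [h1, hxa, hasum, add_zero]
    · have h1 : (S.filter fun θ => a θ * (1 + x θ) ≠ 0) ⊆ S \ (L.filter fun θ => x θ = -1) := by
        intro θ hθ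
        rw [Finset.mem_filter] at hθ
        rw [Finset.mem_sdiff, Finset.mem_filter]
        refine ⟨hθ.1, fun h => hθ.2 ?_⟩
        rw [h.2]; ring
      have h2 := Finset.card_le_card h1
      rw [Finset.card_sdiff_of_subset ((Finset.filter_subset _ _).trans hLS), hSN] at h2
      have h3 : 48 * (S.filter fun θ => a θ * (1 + x θ) ≠ 0).card ≤ 47 * N := by omega
      have h4 : (48 * (S.filter fun θ => a θ * (1 + x θ) ≠ 0).card : ℝ) ≤ 47 * N := by
        exact_mod_cast h3
      linarith
    · have h1 : reluSum k S (fun θ => τ.real {θ} - a θ * (1 + x θ)) α y =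
          -reluSum k L (fun θ => a θ * x θ) α y := by
        unfold reluSum
        rw [← hxS, ← Finset.sum_neg_distrib]
        refine Finset.sum_congr rfl fun θ _ => ?_
        simp only [ha_def]
        ring
      rw [h1, abs_neg]
      refine (hxb α hα y hy).trans ?_
      have h2 : (0 : ℝ) ≤ 2 * (k.factorial * 2 ^ k) * (κ : ℝ) ^ ((k : ℝ) + 1) := by positivity
      have h3 : (0 : ℝ) ≤ (N : ℝ) ^
          (-(1 / 2 : ℝ) - (2 * ((k : ℝ) - (order α : ℝ)) + 1) / (2 * (d : ℝ))) := by positivity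
      nlinarith
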